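/- Let $d,n\ge 1$ be integers and let $\lambda=(\lambda_1\ge\dots\ge\lambda_d)$ be a Young diagram with $d$ rows and $n=\sum_i\lambda_i$ boxes, the boxes being numbered $1,\dots,n$ along rows from left to right, from the top row to the bottom row. Let $f_1,\dots,f_d$ be the standard basis of $\mathbb{C}^d$, put $f_{\mathbf a}=f_{a(1)}\otimes\dots\otimes f_{a(n)}\in(\mathbb{C}^d)^{\otimes n}$, and let $\tau\in S(n)$ act on $(\mathbb{C}^d)^{\otimes n}$ by $\psi_1\otimes\dots\otimes\psi_n\mapsto\psi_{\tau^{-1}(1)}\otimes\dots\otimes\psi_{\tau^{-1}(n)}$. Let $p_\lambda=\sum_\sigma\sigma$, summed over the permutations preserving every row of $\lambda$, let $q_\lambda=\sum_\tau\mathrm{sgn}(\tau)\,\tau$, summed over the permutations preserving every column of $\lambda$, and let $y_\lambda=q_\lambda p_\lambda$. A semistandard tableau of shape $\lambda$ with entries in $\{1,\dots,d\}$ (nondecreasing along rows, strictly increasing down columns), read as a function $\mathbf a:\{1,\dots,n\}\to\{1,\dots,d\}$, is determined by the vector $\mathbf m=(m_{i,j})_{1\le i<j\le d}$, where $m_{i,j}$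 is the number of $j$'s in row $i$; write $f_{\mathbf m}=f_{\mathbf a}$, $|\mathbf m|=\sum_{i<j}m_{i,j}$ and $$|\mathbf m,\lambda\rangle = y_\lambda f_{\mathbf m}/\|y_\lambda f_{\mathbf m}\| .$$ For every $d\ge 1$ there is a constant $C=C(d)>0$ such that for every real $\eta<2/9$ there is a constant $C''=C''(d,\eta)>0$ with the following property. Let $n$, $\delta>0$ and $\lambda$ (as above) satisfy $\lambda_i-\lambda_{i+1}>\delta n$ for all $1\le i\le d-1$, $\lambda_d>\delta n$, and $Cn^{3\eta-1}/\delta^2<1$. Then, for every $\mathbf m$ that is the vector of a semistandard tableau of shape $\lambda$ and satisfies $|\mathbf m|\le n^\eta$, $$\sum_{\mathbf l\ne\mathbf m,\ |\mathbf l|\le n^{\eta}}\bigl|\langle\mathbf m,\lambda\,|\,\mathbf l,\lambda\rangle\bigr|\ \le\ (C''n)^{(9\eta-2)/12}\,\delta^{-1/3},$$ where the sum runs over the vectors $\mathbf l$ of the semistandard tableaux of shape $\lambda$. -/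

import Mathlib

noncomputable section

namespace YoungOverlap

/-- The box of the diagram with row lengths `lam` that carries the number `k` when the boxes are
numbered along the rows, from left to right, starting with the top row. The first component is the
row (counted from `0`), the second the column (counted from `0`). -/
def box {d : ℕ} (lam : Fin d → ℕ) (k : Fin (∑ i, lam i)) : (i : Fin d) × Fin (lam i) :=
  finSigmaFinEquiv.symm k

/-- The row of the `k`-th box. -/
def row {d : ℕ} (lam : Fin d → ℕ) (k : Fin (∑ i, lam i)) : Fin d := (box lam k).1

/-- The column of the `k`-th box. -/
def col {d : ℕ} (lam : Fin d → ℕ) (k : Fin (∑ i, lam i)) : ℕ := ((box lam k).2 : ℕ)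

/-- The Hilbert space `(ℂ^d)^{⊗ n}`, written in coordinates with respect to its orthonormal product
basis `f_a = f_{a(1)} ⊗ ⋯ ⊗ f_{a(n)}`, indexed by the functions `a : Fin n → Fin d`. -/
abbrev TensorSpace (d n : ℕ) : Type := EuclideanSpace ℂ (Fin n → Fin d)

/-- The product basis vector `f_a`. -/
def basisVec {d n : ℕ} (a : Fin n → Fin d) : TensorSpace d n := EuclideanSpace.single a (1 : ℂ)

/-- The action of a permutation on tensors,
`ψ_1 ⊗ ⋯ ⊗ ψ_n ↦ ψ_{τ⁻¹(1)} ⊗ ⋯ ⊗ ψ_{τ⁻¹(n)}`. -/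
def permOp {d n : ℕ} (τ : Equiv.Perm (Fin n)) : TensorSpace d n →ₗ[ℂ] TensorSpace d n where
  toFun v := WithLp.toLp 2 (fun a => v (a ∘ τ))
  map_add' _ _ := rfl
  map_smul' _ _ := rfl

/-- On product basis vectors the permutation `τ` acts by `f_a ↦ f_{a ∘ τ⁻¹}`. -/
theorem permOp_basisVec {d n : ℕ} (τ : Equiv.Perm (Fin n)) (a : Fin n → Fin d) :
    permOp τ (basisVec a) = basisVec (a ∘ τ.symm) := by
  ext b
  have h : b ∘ τ = a ↔ b = a ∘ τ.symm := by
    constructor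
    · rintro rfl
      funext x
      simp
    · rintro rfl
      funext x
      simp
  change (basisVec a : TensorSpace d n) (b ∘ τ) = basisVec (a ∘ τ.symm) b
  simp [basisVec, h]

/-- The permutations that leave every row invariant. -/
def rowPerms {d : ℕ} (lam : Fin d → ℕ) : Finset (Equiv.Perm (Fin (∑ i, lam i))) :=
  {σ | ∀ k, row lam (σ k) = row lam k}

/-- The permutations that leave every column invariant. -/
def colPerms {d : ℕ} (lam : Fin d → ℕ) : Finset (Equiv.Perm (Fin (∑ i, lam i))) :=
  {τ | ∀ k, col lam (τ k) = col lam k}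

/-- The row symmetriser `p_λ`. -/
def rowSym {d : ℕ} (lam : Fin d → ℕ) :
    TensorSpace d (∑ i, lam i) →ₗ[ℂ] TensorSpace d (∑ i, lam i) :=
  ∑ σ ∈ rowPerms lam, permOp σ

/-- The column antisymmetriser `q_λ`. -/
def colAntisym {d : ℕ} (lam : Fin d → ℕ) :
    TensorSpace d (∑ i, lam i) →ₗ[ℂ] TensorSpace d (∑ i, lam i) :=
  ∑ τ ∈ colPerms lam, ((Equiv.Perm.sign τ : ℤ) : ℂ) • permOp τ

/-- The Young symmetriser `y_λ = q_λ p_λ`. -/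
def youngSym {d : ℕ} (lam : Fin d → ℕ) :
    TensorSpace d (∑ i, lam i) →ₗ[ℂ] TensorSpace d (∑ i, lam i) :=
  colAntisym lam ∘ₗ rowSym lam

/-- A filling `a` of the boxes is semistandard: nondecreasing along rows from left to right and
strictly increasing along columns from top to bottom. -/
def IsSemistandard {d : ℕ} (lam : Fin d → ℕ) (a : Fin (∑ i, lam i) → Fin d) : Prop :=
  (∀ k l, row lam k = row lam l → col lam k ≤ col lam l → a k ≤ a l) ∧
    (∀ k l, col lam k = col lam l → row lam k < row lam l → a k < a l)

instance {d : ℕ} (lam : Fin d → ℕ) : DecidablePred (IsSemistandard lam) := fun a => by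
  unfold IsSemistandard
  infer_instance

/-- The semistandard Young tableaux of shape `lam` with entries in a `d`-element set. These are
the labels `(m, λ)`. -/
abbrev Tableau {d : ℕ} (lam : Fin d → ℕ) : Type := {a // IsSemistandard lam a}

/-- `m_{i,j}`, the number of entries `j` in row `i`. -/
def Tableau.mult {d : ℕ} {lam : Fin d → ℕ} (t : Tableau lam) (i j : Fin d) : ℕ :=
  Finset.card {k : Fin (∑ i, lam i) | row lam k = i ∧ t.1 k = j}

/-- `|m| = ∑_{i<j} m_{i,j}`. -/
def Tableau.total {d : ℕ} {lam : Fin d → ℕ} (t : Tableau lam) : ℕ :=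
  ∑ i : Fin d, ∑ j ∈ Finset.Ioi i, t.mult i j

/-- The normalised vector `|m, λ⟩ = y_λ f_m / ‖y_λ f_m‖`. -/
def Tableau.ket {d : ℕ} {lam : Fin d → ℕ} (t : Tableau lam) : TensorSpace d (∑ i, lam i) :=
  ((‖youngSym lam (basisVec t.1)‖⁻¹ : ℝ) : ℂ) • youngSym lam (basisVec t.1)

end YoungOverlap

end

/-! Up to a positive factor that normalisation removes, `|m,λ⟩` is `q_λ` applied to the sum of `f_x`
over the row class of `m`. As `q_λ* q_λ` is a multiple of `q_λ`, overlaps are quotients of entries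
of `gram`, which sums `colSign x y` over `x` in the class of `m` and `y` in that of `l`. This
coefficient lies in {-1, 0, 1}; it vanishes unless `y` has no repeated value in a column and `x`
arises from `y` by permuting within columns.

Read fillings column by column and call an entry modified if it exceeds its row index. At most `N =
n^η` entries are modified, whereas for `p = (i,j)`, `i < j`, the strip of columns meeting row `i`
but not row `j` has `D_p > t = δn` elements. Typically a column has at most one modified entry, a
`j` in row `i` of a column of the strip, and the number of such fillings is about `mass = ∏
D_p^{m_p} / m_p!`. They give the main part of the diagonal of `gram` (`half_mass_le_gram`).

A pair `x ≠ y` has a special column, one where the two fillings differ or have several modified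
entries. Once the special columns are fixed, the others form a marking with the remaining content.
Comparing the number of markings with `√(mass m * mass l)` charges a factor `√(N/D_p)` for each
modified entry in a special column, on either side. The sum over all pairs, and with it the sum over
`l`, is thus at most a product over columns minus 1 (`sum_linked_le`). A special column carries at
least three such factors, one on each side belonging to a strip that contains the column
(`Linked.weight_le`). Summing two factors over a strip gives `N`; the third is at most `√(N/t)`. The
total is `O(√(N³/t))`, which the hypothesis on `C` makes small and which is then weakened to the
stated power. -/

namespace YoungOverlap

open Finset

set_option linter.unusedSectionVars false

/-! ### Counting partial labellings -/

section Markings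

variable {X P : Type*} [Fintype X] [DecidableEq X] [Fintype P] [DecidableEq P]

/-- The partial labellings of `X` that use the label `p` exactly `m p` times, inside `S p`. -/
def markings (S : P → Finset X) (m : P → ℕ) : Finset (X → Option P) :=
  {g | (∀ c p, g c = some p → c ∈ S p) ∧ ∀ p, #{c | g c = some p} = m p}

theorem mem_markings {S : P → Finset X} {m : P → ℕ} {g : X → Option P} :
    g ∈ markings S m ↔ (∀ c p, g c = some p → c ∈ S p) ∧ ∀ p, #{c | g c = some p} = m p := by
  simp [markings]

theorem card_update_some {g : X → Option P} {c : X} (hc : g c = none) (p q : P) :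
    #{x | Function.update g c (some p) x = some q}
      = #{x | g x = some q} + (Pi.single p 1 : P → ℕ) q := by
  by_cases h : q = p
  · subst h
    have : ({x | Function.update g c (some q) x = some q} : Finset X)
        = insert c ({x | g x = some q} : Finset X) := by
      ext x
      by_cases hx : x = c
      · subst hx; simp
      · simp [hx]
    rw [this, card_insert_of_notMem (by simp [hc])]
    simp
  · have : ({x | Function.update g c (some p) x = some q} : Finset X)
        = ({x | g x = some q} : Finset X) := by
      ext x
      by_cases hx : x = c
      · subst hx; simp [hc, Ne.symm h]
      · simp [hx]
    rw [this]
    simp [h]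

/-- Double counting of markings with a distinguished element labelled `p`: erasing that label leaves
a smaller marking and a free element of `S p`. -/
theorem card_markings_add_single (S : P → Finset X) (m : P → ℕ) (p : P) :
    #(markings S (m + Pi.single p 1)) * (m p + 1)
      = ∑ g ∈ markings S m, #{c ∈ S p | g c = none} := by
  have h1 : #(markings S (m + Pi.single p 1)) * (m p + 1)
      = ∑ g ∈ markings S (m + Pi.single p 1), #{c | g c = some p} := by
    rw [sum_const_nat (m := m p + 1)]
    intro g hg
    rw [(mem_markings.1 hg).2 p]
    simp
  rw [h1, ← card_sigma, ← card_sigma]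
  refine card_bij' (fun x _ => ⟨Function.update x.1 x.2 none, x.2⟩)
    (fun x _ => ⟨Function.update x.1 x.2 (some p), x.2⟩) ?_ ?_ ?_ ?_
  · rintro ⟨g, c⟩ h
    simp only [mem_sigma, mem_filter, mem_univ, true_and] at h ⊢
    obtain ⟨hg, hc⟩ := h
    rw [mem_markings] at hg
    refine ⟨mem_markings.2 ⟨fun x q hx => ?_, fun q => ?_⟩, hg.1 _ _ hc, by simp⟩
    · by_cases hxc : x = c
      · subst hxc; simp at hx
      · exact hg.1 x q (by simpa [hxc] using hx)
    · have h2 := card_update_some (g := Function.update g c none) (c := c) (by simp) p q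
      have h3 : Function.update (Function.update g c none) c (some p) = g := by
        simp [← hc]
      rw [h3, hg.2 q, Pi.add_apply] at h2
      omega
  · rintro ⟨g, c⟩ h
    simp only [mem_sigma, mem_filter, mem_univ, true_and] at h ⊢
    obtain ⟨hg, hc, hn⟩ := h
    rw [mem_markings] at hg
    refine ⟨mem_markings.2 ⟨fun x q hx => ?_, fun q => ?_⟩, by simp⟩
    · by_cases hxc : x = c
      · subst hxc
        simp only [Function.update_self, Option.some.injEq] at hx
        exact hx ▸ hc
      · exact hg.1 x q (by simpa [hxc] using hx)
    · rw [card_update_some hn, hg.2 q, Pi.add_apply]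
  · rintro ⟨g, c⟩ h
    simp only [mem_sigma, mem_filter, mem_univ, true_and] at h
    simp [← h.2]
  · rintro ⟨g, c⟩ h
    simp only [mem_sigma, mem_filter] at h
    simp [← h.2.2]

theorem induction_add_single {motive : (P → ℕ) → Prop} (zero : motive 0)
    (add : ∀ m p, motive m → motive (m + Pi.single p 1)) (m : P → ℕ) : motive m := by
  induction hk : ∑ p, m p generalizing m with
  | zero =>
    have : m = 0 := by
      funext p
      exact (sum_eq_zero_iff.1 hk) p (mem_univ _)
    exact this ▸ zero
  | succ k ih =>
    obtain ⟨p, hp⟩ : ∃ p, m p ≠ 0 := by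
      by_contra! h
      simp [h] at hk
    have hm : m = (m - Pi.single p 1) + Pi.single p 1 := by
      funext q
      by_cases hq : q = p
      · subst hq; simp; omega
      · simp [hq]
    rw [hm]
    refine add _ _ (ih _ ?_)
    have h2 : ∑ q, m q = ∑ q, (m - Pi.single p 1 : P → ℕ) q + ∑ q, (Pi.single p 1 : P → ℕ) q := by
      rw [← sum_add_distrib]
      exact sum_congr rfl fun q _ => congrFun hm q
    rw [sum_pi_single'] at h2
    simp only [mem_univ, if_true] at h2
    omega

/-- The approximate number of markings. -/
noncomputable def mass (D : P → ℕ) (m : P → ℕ) : ℝ := ∏ p, (D p : ℝ) ^ m p / (m p).factorial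

theorem mass_nonneg (D m : P → ℕ) : 0 ≤ mass D m := prod_nonneg fun _ _ => by positivity

theorem mass_pos {D m : P → ℕ} (h : ∀ p, m p ≠ 0 → D p ≠ 0) : 0 < mass D m := by
  refine prod_pos fun p _ => ?_
  by_cases hp : m p = 0
  · simp [hp]
  · have := Nat.pos_of_ne_zero (h p hp)
    positivity

theorem mass_add_single (D m : P → ℕ) (p : P) :
    mass D (m + Pi.single p 1) * (m p + 1) = mass D m * D p := by
  unfold mass
  rw [← mul_prod_erase univ _ (mem_univ p), ← mul_prod_erase univ _ (mem_univ p)]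
  have : ∏ q ∈ univ.erase p, (D q : ℝ) ^ (m + Pi.single p 1 : P → ℕ) q / ((m + Pi.single p 1 : P → ℕ) q).factorial
      = ∏ q ∈ univ.erase p, (D q : ℝ) ^ m q / (m q).factorial := by
    refine prod_congr rfl fun q hq => ?_
    simp [ne_of_mem_erase hq]
  rw [this]
  simp only [Pi.add_apply, Pi.single_eq_same, pow_succ, Nat.factorial_succ, Nat.cast_mul,
    Nat.cast_add, Nat.cast_one]
  have h1 : ((m p).factorial : ℝ) ≠ 0 := by positivity
  have h2 : (m p : ℝ) + 1 ≠ 0 := by positivity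
  field_simp

theorem card_markings_zero (S : P → Finset X) : #(markings S 0) = 1 := by
  rw [card_eq_one]
  refine ⟨fun _ => none, ?_⟩
  ext g
  rw [mem_markings, mem_singleton]
  constructor
  · rintro ⟨-, h⟩
    funext c
    cases hc : g c with
    | none => rfl
    | some p =>
      have := h p
      simp only [Pi.zero_apply, card_eq_zero, filter_eq_empty_iff] at this
      exact absurd hc (this (mem_univ c))
  · rintro rfl
    simp

theorem card_markings_le (S : P → Finset X) (m : P → ℕ) :
    (#(markings S m) : ℝ) ≤ mass (fun p => #(S p)) m := by
  induction m using induction_add_single with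
  | zero => simp [card_markings_zero, mass]
  | add m p ih =>
    have h1 : (#(markings S (m + Pi.single p 1)) * (m p + 1) : ℝ) ≤ #(markings S m) * #(S p) := by
      have : #(markings S (m + Pi.single p 1)) * (m p + 1) ≤ #(markings S m) * #(S p) := by
        rw [card_markings_add_single]
        exact sum_le_card_nsmul _ _ _ fun g _ => card_filter_le _ _
      exact_mod_cast this
    have h2 := mass_add_single (fun p => #(S p)) m p
    have h3 : (0 : ℝ) < m p + 1 := by positivity
    refine le_of_mul_le_mul_right ?_ h3
    rw [h2]
    exact h1.trans (mul_le_mul_of_nonneg_right ih (by positivity))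

theorem sum_card_eq_some (g : X → Option P) :
    ∑ p, #{c | g c = some p} = #{c | g c ≠ none} := by
  rw [← card_biUnion]
  · congr 1
    ext c
    simp [Option.ne_none_iff_exists']
  · intro p _ q _ hpq
    refine disjoint_left.2 fun c hc hc' => hpq ?_
    simp only [mem_filter, mem_univ, true_and] at hc hc'
    rw [hc] at hc'
    exact Option.some.inj hc'

/-- At most `N` elements are ever occupied, so each new label `p` still has at least `#(S p) - N`
free places and costs at most a factor `θ` against `mass`. -/
theorem le_card_markings {S : P → Finset X} {θ : ℝ} {N : ℝ} (hθ : 0 ≤ θ) (m : P → ℕ)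
    (hS : ∀ p, m p ≠ 0 → θ * #(S p) ≤ #(S p) - N) (hm : (∑ p, m p : ℕ) ≤ N) :
    θ ^ (∑ p, m p) * mass (fun p => #(S p)) m ≤ #(markings S m) := by
  induction m using induction_add_single with
  | zero => simp [card_markings_zero, mass]
  | add m p ih =>
    have hsum : ∑ q, (m + Pi.single p 1 : P → ℕ) q = ∑ q, m q + 1 := by
      simp only [Pi.add_apply, sum_add_distrib, sum_pi_single', mem_univ, if_true]
    rw [hsum] at hm ⊢
    push_cast at hm
    have ih' := ih (fun q hq => hS q (by simp [hq])) (by push_cast; linarith)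
    have h1 : #(markings S m) * ((#(S p) : ℝ) - N)
        ≤ #(markings S (m + Pi.single p 1)) * (m p + 1) := by
      have : (#(markings S (m + Pi.single p 1)) * (m p + 1) : ℝ)
          = ∑ g ∈ markings S m, (#{c ∈ S p | g c = none} : ℝ) := by
        exact_mod_cast card_markings_add_single S m p
      rw [this, ← nsmul_eq_mul]
      refine card_nsmul_le_sum _ _ _ fun g hg => ?_
      have h4 : #(S p) ≤ #{c ∈ S p | g c = none} + #{c | g c ≠ none} := by
        rw [← card_filter_add_card_filter_not (s := S p) (fun c => g c = none)]
        gcongr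
        exact subset_univ _
      rw [← sum_card_eq_some, sum_congr rfl fun q _ => (mem_markings.1 hg).2 q] at h4
      have h5 : (#(S p) : ℝ) ≤ #{c ∈ S p | g c = none} + ∑ q, (m q : ℝ) := by exact_mod_cast h4
      linarith
    have h2 := mass_add_single (fun p => #(S p)) m p
    have h3 : (0 : ℝ) < m p + 1 := by positivity
    refine le_of_mul_le_mul_right ?_ h3
    refine le_trans ?_ h1
    calc θ ^ (∑ q, m q + 1) * mass (fun p => #(S p)) (m + Pi.single p 1) * (m p + 1)
        = (θ ^ (∑ q, m q) * mass (fun p => #(S p)) m) * (θ * #(S p)) := by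
          rw [mul_assoc, h2, pow_succ]; ring
      _ ≤ #(markings S m) * (θ * #(S p)) := by gcongr
      _ ≤ _ := by
          refine mul_le_mul_of_nonneg_left (hS p (by simp)) (by positivity)

/-- The quotient `(r+x)! / r!` has `x` factors, each at most `r + x ≤ N`; each removed label
therefore costs `N / D p`. -/
theorem mass_le_mul_prod (D r x : P → ℕ) {N : ℝ} (hD : ∀ p, x p ≠ 0 → D p ≠ 0)
    (hN : ∀ p, (r p + x p : ℝ) ≤ N) :
    mass D r ≤ mass D (r + x) * ∏ p, (N / D p) ^ x p := by
  unfold mass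
  rw [← prod_mul_distrib]
  refine prod_le_prod (fun _ _ => by positivity) fun p _ => ?_
  by_cases hx : x p = 0
  · simp [hx]
  have hDp : (0 : ℝ) < D p := by exact_mod_cast Nat.pos_of_ne_zero (hD p hx)
  have hf : ((r p + x p).factorial : ℝ) ≤ (r p).factorial * N ^ x p := by
    have h1 : (r p + x p).factorial ≤ (r p).factorial * (r p + x p) ^ x p := by
      rw [← Nat.factorial_mul_ascFactorial]
      gcongr
      exact Nat.ascFactorial_le_pow_add _ _
    calc ((r p + x p).factorial : ℝ) ≤ (r p).factorial * ((r p + x p : ℕ) : ℝ) ^ x p := by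
          exact_mod_cast h1
      _ ≤ _ := by
          gcongr
          push_cast
          exact hN p
  have h0 : (0 : ℝ) < (r p).factorial := by positivity
  have h1 : (0 : ℝ) < (r p + x p).factorial := by positivity
  simp only [Pi.add_apply]
  rw [div_pow, pow_add, div_mul_div_comm, div_le_div_iff₀ h0 (by positivity)]
  calc (D p : ℝ) ^ r p * ((r p + x p).factorial * (D p : ℝ) ^ x p)
      ≤ (D p : ℝ) ^ r p * (((r p).factorial * N ^ x p) * (D p : ℝ) ^ x p) := by gcongr
    _ = _ := by ring

end Markings

/-! ### Fillings of a single column -/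

section Columns

variable {d : ℕ}

/-- The columns that meet row `p.1` but not row `p.2`. -/
def strip (lam : Fin d → ℕ) (p : Fin d × Fin d) : Finset (Fin (∑ i, lam i)) :=
  {c | lam p.2 ≤ c ∧ (c : ℕ) < lam p.1}

theorem mem_strip {lam : Fin d → ℕ} {p : Fin d × Fin d} {c : Fin (∑ i, lam i)} :
    c ∈ strip lam p ↔ lam p.2 ≤ c ∧ (c : ℕ) < lam p.1 := by simp [strip]

theorem le_sum_rows (lam : Fin d → ℕ) (i : Fin d) : lam i ≤ ∑ i, lam i :=
  single_le_sum (f := lam) (fun _ _ => Nat.zero_le _) (mem_univ i)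

theorem card_strip (lam : Fin d → ℕ) (p : Fin d × Fin d) :
    #(strip lam p) = lam p.1 - lam p.2 := by
  rw [← Nat.card_Ico, ← card_map Fin.valEmbedding]
  congr 1
  ext c
  simp only [mem_map, mem_strip, Fin.valEmbedding_apply, mem_Ico]
  constructor
  · rintro ⟨x, hx, rfl⟩
    exact hx
  · intro h
    exact ⟨⟨c, h.2.trans_le (le_sum_rows lam _)⟩, h, rfl⟩

/-- Whether the column filling `u` has the entry `p.2` in row `p.1`, with `p.1 < p.2`. -/
def mods (u : Fin d → Fin d) (p : Fin d × Fin d) : ℕ := if p.1 < p.2 ∧ u p.1 = p.2 then 1 else 0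

theorem mods_ext {u v : Fin d → Fin d} (hu : ∀ i, i ≤ u i) (hv : ∀ i, i ≤ v i)
    (h : ∀ p, mods u p = mods v p) : u = v := by
  funext i
  by_contra hne
  rcases (hu i).lt_or_eq with hi | hi
  · have := h (i, u i)
    simp [mods, hi, Ne.symm hne] at this
  · rcases (hv i).lt_or_eq with hi' | hi'
    · have := h (i, v i)
      simp [mods, hi', hne] at this
    · exact hne (hi.symm.trans hi')

/-- The rows met by the column `c`. -/
def rowsOf (lam : Fin d → ℕ) (c : ℕ) : Finset (Fin d) := {i | c < lam i}

theorem mem_rowsOf {lam : Fin d → ℕ} {c : ℕ} {i : Fin d} : i ∈ rowsOf lam c ↔ c < lam i := by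
  simp [rowsOf]

/-- The fillings of the column `c` that use no value twice and whose entry in row `i` is at
least `i`. Outside of the diagram they are extended by the identity. -/
structure IsColumn (lam : Fin d → ℕ) (c : ℕ) (u : Fin d → Fin d) : Prop where
  le : ∀ i, i ≤ u i
  eq_of_le : ∀ i, lam i ≤ c → u i = i
  injOn : Set.InjOn u (rowsOf lam c)

/-- Two column fillings with the same content. -/
structure Linked (lam : Fin d → ℕ) (c : ℕ) (u w : Fin d → Fin d) : Prop where
  left : IsColumn lam c u
  right : IsColumn lam c w
  image_eq : (rowsOf lam c).image u = (rowsOf lam c).image w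

/-- Two equal column fillings with at most one entry that differs from its row index. -/
def Simple (u w : Fin d → Fin d) : Prop := u = w ∧ ∀ i j, u i ≠ i → u j ≠ j → i = j

theorem Linked.symm {lam : Fin d → ℕ} {c : ℕ} {u w : Fin d → Fin d} (h : Linked lam c u w) :
    Linked lam c w u := ⟨h.right, h.left, h.image_eq.symm⟩

/-- Under `hu` the filling permutes the rows met by the column; a permutation with `i ≤ u i`
preserves the sum of the indices, so every inequality is an equality. -/
theorem IsColumn.eq_id {lam : Fin d → ℕ} {c : ℕ} {u : Fin d → Fin d} (h : IsColumn lam c u)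
    (hu : ∀ i, c < lam i → c < lam (u i)) : u = id := by
  have himg : (rowsOf lam c).image u = rowsOf lam c := by
    refine eq_of_subset_of_card_le ?_ (card_image_of_injOn h.injOn).ge
    intro j hj
    obtain ⟨i, hi, rfl⟩ := mem_image.1 hj
    exact mem_rowsOf.2 (hu i (mem_rowsOf.1 hi))
  have hsum : ∑ i ∈ rowsOf lam c, (i : ℕ) = ∑ i ∈ rowsOf lam c, (u i : ℕ) := by
    conv_lhs => rw [← himg]
    rw [sum_image h.injOn]
  have := (sum_eq_sum_iff_of_le fun i _ => Fin.le_def.1 (h.le i)).1 hsum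
  funext i
  by_cases hi : c < lam i
  · exact (Fin.ext (this i (mem_rowsOf.2 hi))).symm
  · exact h.eq_of_le i (not_lt.1 hi)

/-- The exit `(i, u i)` places the column `c` in `strip lam (i, u i)`. This is what lets a sum over
columns be bounded by sizes of strips. -/
theorem IsColumn.exists_exit {lam : Fin d → ℕ} {c : ℕ} {u : Fin d → Fin d}
    (h : IsColumn lam c u) (hu : u ≠ id) : ∃ i, c < lam i ∧ lam (u i) ≤ c ∧ i < u i := by
  by_contra! hcon
  refine hu (h.eq_id fun i hi => ?_)
  by_contra hlt
  have := hcon i hi (not_lt.1 hlt)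
  have heq : u i = i := le_antisymm this (h.le i)
  rw [heq] at hlt
  exact hlt hi

theorem Linked.eq_id {lam : Fin d → ℕ} {c : ℕ} {w : Fin d → Fin d}
    (h : Linked lam c id w) : w = id := by
  refine h.right.eq_id fun i hi => ?_
  have : w i ∈ (rowsOf lam c).image id := by
    rw [h.image_eq]
    exact mem_image_of_mem _ (mem_rowsOf.2 hi)
  rw [image_id] at this
  exact mem_rowsOf.1 this

theorem Linked.ne_id {lam : Fin d → ℕ} {c : ℕ} {u w : Fin d → Fin d}
    (h : Linked lam c u w) (hs : ¬ Simple u w) : u ≠ id := by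
  rintro rfl
  exact hs ⟨h.eq_id.symm, fun i j hi => absurd rfl hi⟩

/-- If both fillings had only their exit modified, equality of contents would force the two exits
into the same row with the same value, so the pair would be simple. -/
theorem Linked.exists_second {lam : Fin d → ℕ} {c : ℕ} {u w : Fin d → Fin d}
    (h : Linked lam c u w) (hs : ¬ Simple u w) {i i' : Fin d} (hi : c < lam i)
    (hui : lam (u i) ≤ c) (hi' : c < lam i') (hwi' : lam (w i') ≤ c) :
    (∃ j, j ≠ i ∧ j < u j) ∨ ∃ j, j ≠ i' ∧ j < w j := by
  by_contra! hcon
  obtain ⟨h1, h2⟩ := hcon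
  have hu : ∀ j, j ≠ i → u j = j := fun j hj => le_antisymm (h1 j hj) (h.left.le j)
  have hw : ∀ j, j ≠ i' → w j = j := fun j hj => le_antisymm (h2 j hj) (h.right.le j)
  have hne : u i ≠ i := fun h => by rw [h] at hui; omega
  have hii : i = i' := by
    by_contra hii
    have h3 : i ∈ (rowsOf lam c).image w := mem_image.2 ⟨i, mem_rowsOf.2 hi, hw i hii⟩
    rw [← h.image_eq] at h3
    obtain ⟨k, -, hk⟩ := mem_image.1 h3
    by_cases hki : k = i
    · exact hne (hki ▸ hk)
    · exact hki ((hu k hki).symm.trans hk)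
  subst hii
  have h4 : u i ∈ (rowsOf lam c).image w := by
    rw [← h.image_eq]
    exact mem_image_of_mem _ (mem_rowsOf.2 hi)
  obtain ⟨k, hk, hwk⟩ := mem_image.1 h4
  have hki : k = i := by
    by_contra hki
    rw [hw k hki] at hwk
    rw [← hwk] at hui
    exact absurd (mem_rowsOf.1 hk) (not_lt.2 hui)
  subst hki
  refine hs ⟨funext fun j => ?_, fun a b ha hb => ?_⟩
  · by_cases hj : j = k
    · rw [hj, hwk]
    · rw [hu j hj, hw j hj]
  · have ha' : a = k := by_contra fun hc => ha (hu a hc)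
    have hb' : b = k := by_contra fun hc => hb (hu b hc)
    rw [ha', hb']

section Weight

variable {z : Fin d × Fin d → ℝ} {κ : ℝ}

theorem prod_pow_mods (z : Fin d × Fin d → ℝ) (u : Fin d → Fin d) :
    ∏ p, z p ^ mods u p = ∏ i, if i < u i then z (i, u i) else 1 := by
  rw [Fintype.prod_prod_type]
  refine prod_congr rfl fun i _ => ?_
  rw [prod_eq_single (u i)]
  · by_cases h : i < u i <;> simp [mods, h]
  · intro j _ hj
    simp [mods, Ne.symm hj]
  · simp

theorem prod_pow_mods_nonneg (hz : ∀ p, 0 ≤ z p) (u : Fin d → Fin d) :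
    0 ≤ ∏ p, z p ^ mods u p := prod_nonneg fun p _ => pow_nonneg (hz p) _

theorem prod_pow_mods_le (hz : ∀ p, 0 ≤ z p) (hz1 : ∀ p, p.1 < p.2 → z p ≤ 1)
    {u : Fin d → Fin d} {i : Fin d} (hi : i < u i) : ∏ p, z p ^ mods u p ≤ z (i, u i) := by
  rw [prod_pow_mods, ← mul_prod_erase univ _ (mem_univ i), if_pos hi]
  refine mul_le_of_le_one_right (hz _) (prod_le_one (fun j _ => ?_) fun j _ => ?_)
  · split_ifs
    exacts [hz _, zero_le_one]
  · split_ifs with h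
    exacts [hz1 _ h, le_rfl]

theorem prod_pow_mods_le_mul (hz : ∀ p, 0 ≤ z p) (hz1 : ∀ p, p.1 < p.2 → z p ≤ 1)
    {u : Fin d → Fin d} {i j : Fin d} (hi : i < u i) (hj : j < u j) (hji : j ≠ i) :
    ∏ p, z p ^ mods u p ≤ z (i, u i) * z (j, u j) := by
  rw [prod_pow_mods, ← mul_prod_erase univ _ (mem_univ i), if_pos hi,
    ← mul_prod_erase (univ.erase i) _ (mem_erase.2 ⟨hji, mem_univ j⟩), if_pos hj]
  refine mul_le_mul_of_nonneg_left ?_ (hz _)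
  refine mul_le_of_le_one_right (hz _) (prod_le_one (fun j _ => ?_) fun j _ => ?_)
  · split_ifs
    exacts [hz _, zero_le_one]
  · split_ifs with h
    exacts [hz1 _ h, le_rfl]

/-- Three modified entries are available: an exit on each side and a further one from
`Linked.exists_second`. The further one is bounded by `κ`, the product of the exits by the square of
the larger; all other factors are at most 1. -/
theorem Linked.weight_le {lam : Fin d → ℕ} {c : Fin (∑ i, lam i)} {u w : Fin d → Fin d}
    (h : Linked lam c u w) (hs : ¬ Simple u w) (hz : ∀ p, 0 ≤ z p)
    (hz1 : ∀ p, p.1 < p.2 → z p ≤ 1) (hzκ : ∀ p, p.1 < p.2 → z p ≤ κ) :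
    ∃ p, c ∈ strip lam p ∧
      (∏ p, z p ^ mods u p) * (∏ p, z p ^ mods w p) ≤ κ * z p ^ 2 := by
  have hs' : ¬ Simple w u := fun hs' => hs ⟨hs'.1.symm, hs'.1 ▸ hs'.2⟩
  obtain ⟨i, hi, hui, hiu⟩ := h.left.exists_exit (h.ne_id hs)
  obtain ⟨i', hi', hwi', hiw⟩ := h.right.exists_exit (h.symm.ne_id hs')
  have key : (∏ p, z p ^ mods u p) * (∏ p, z p ^ mods w p)
      ≤ κ * (z (i, u i) * z (i', w i')) := by
    rcases h.exists_second hs hi hui hi' hwi' with ⟨j, hj, hju⟩ | ⟨j, hj, hjw⟩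
    · calc _ ≤ (z (i, u i) * z (j, u j)) * z (i', w i') :=
            mul_le_mul (prod_pow_mods_le_mul hz hz1 hiu hju hj) (prod_pow_mods_le hz hz1 hiw)
              (prod_pow_mods_nonneg hz _) (mul_nonneg (hz _) (hz _))
        _ = z (j, u j) * (z (i, u i) * z (i', w i')) := by ring
        _ ≤ _ := mul_le_mul_of_nonneg_right (hzκ _ hju) (mul_nonneg (hz _) (hz _))
    · calc _ ≤ z (i, u i) * (z (i', w i') * z (j, w j)) :=
            mul_le_mul (prod_pow_mods_le hz hz1 hiu) (prod_pow_mods_le_mul hz hz1 hiw hjw hj)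
              (prod_pow_mods_nonneg hz _) (hz _)
        _ = z (j, w j) * (z (i, u i) * z (i', w i')) := by ring
        _ ≤ _ := mul_le_mul_of_nonneg_right (hzκ _ hjw) (mul_nonneg (hz _) (hz _))
  have hκ : 0 ≤ κ := (hz _).trans (hzκ (i, u i) hiu)
  rcases le_total (z (i, u i)) (z (i', w i')) with hle | hle
  · refine ⟨(i', w i'), mem_strip.2 ⟨hwi', hi'⟩, key.trans ?_⟩
    rw [sq]
    exact mul_le_mul_of_nonneg_left (mul_le_mul_of_nonneg_right hle (hz _)) hκ
  · refine ⟨(i, u i), mem_strip.2 ⟨hui, hi⟩, key.trans ?_⟩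
    rw [sq]
    exact mul_le_mul_of_nonneg_left (mul_le_mul_of_nonneg_left hle (hz _)) hκ

open Classical in
/-- The pairs of column fillings that are linked but not simple. -/
noncomputable def specials (lam : Fin d → ℕ) (c : ℕ) : Finset ((Fin d → Fin d) × (Fin d → Fin d)) :=
  {x | Linked lam c x.1 x.2 ∧ ¬ Simple x.1 x.2}

/-- The weight of a pair of column fillings. -/
noncomputable def pairWeight (z : Fin d × Fin d → ℝ) (x : (Fin d → Fin d) × (Fin d → Fin d)) : ℝ :=
  (∏ p, z p ^ mods x.1 p) * ∏ p, z p ^ mods x.2 p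

theorem pairWeight_nonneg (hz : ∀ p, 0 ≤ z p) (x : (Fin d → Fin d) × (Fin d → Fin d)) :
    0 ≤ pairWeight z x := mul_nonneg (prod_pow_mods_nonneg hz _) (prod_pow_mods_nonneg hz _)

/-- There are at most `(d^d)^2` pairs per column and `d^2` strips, and each strip contributes `D_p *
(N / D_p) ≤ N`. -/
theorem sum_pairWeight_le (lam : Fin d → ℕ) {N : ℝ} (hN : 0 ≤ N) (hκ : 0 ≤ κ)
    (hz : ∀ p, 0 ≤ z p) (hzN : ∀ p, z p ^ 2 = N / #(strip lam p))
    (hz1 : ∀ p, p.1 < p.2 → z p ≤ 1) (hzκ : ∀ p, p.1 < p.2 → z p ≤ κ) :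
    ∑ c : Fin (∑ i, lam i), ∑ x ∈ specials lam c, pairWeight z x
      ≤ ((d : ℝ) ^ d) ^ 2 * (κ * (d ^ 2 * N)) := by
  have h1 : ∀ c : Fin (∑ i, lam i), ∀ x ∈ specials lam c, pairWeight z x
      ≤ κ * ∑ p, if c ∈ strip lam p then z p ^ 2 else 0 := by
    intro c x hx
    simp only [specials, mem_filter, mem_univ, true_and] at hx
    obtain ⟨p, hp, hle⟩ := hx.1.weight_le hx.2 hz hz1 hzκ
    refine hle.trans (mul_le_mul_of_nonneg_left ?_ hκ)
    have := single_le_sum (f := fun p => if c ∈ strip lam p then z p ^ 2 else 0) (s := univ)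
      (fun q _ => by split_ifs; exacts [sq_nonneg _, le_rfl]) (mem_univ p)
    simpa [hp] using this
  have h2 : ∀ c : Fin (∑ i, lam i), ∑ x ∈ specials lam c, pairWeight z x
      ≤ ((d : ℝ) ^ d) ^ 2 * (κ * ∑ p, if c ∈ strip lam p then z p ^ 2 else 0) := by
    intro c
    refine (sum_le_card_nsmul _ _ _ (h1 c)).trans ?_
    rw [nsmul_eq_mul]
    refine mul_le_mul_of_nonneg_right ?_ (mul_nonneg hκ (sum_nonneg fun q _ => ?_))
    · have : #(specials lam c) ≤ (d ^ d) ^ 2 := by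
        refine (card_le_univ _).trans ?_
        simp [Fintype.card_prod, sq]
      exact_mod_cast this
    · split_ifs
      exacts [sq_nonneg _, le_rfl]
  refine (sum_le_sum fun c _ => h2 c).trans ?_
  rw [← mul_sum, ← mul_sum, sum_comm]
  refine mul_le_mul_of_nonneg_left (mul_le_mul_of_nonneg_left ?_ hκ) (by positivity)
  have h3 : ∀ p : Fin d × Fin d, ∑ c, (if c ∈ strip lam p then z p ^ 2 else 0) ≤ N := by
    intro p
    rw [sum_ite_mem, univ_inter, sum_const, nsmul_eq_mul, hzN]
    rcases eq_or_ne (#(strip lam p) : ℝ) 0 with h0 | h0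
    · simpa [h0] using hN
    · rw [mul_div_cancel₀ _ h0]
  calc _ ≤ ∑ _p : Fin d × Fin d, N := sum_le_sum fun p _ => h3 p
    _ = d ^ 2 * N := by simp [sq]

end Weight

end Columns

/-! ### Pairs of fillings: special columns and the remaining marking -/

section Pairs

variable {d : ℕ}

theorem mods_le_one (u : Fin d → Fin d) (p : Fin d × Fin d) : mods u p ≤ 1 := by
  unfold mods
  split_ifs <;> simp

theorem mods_eq_one {u : Fin d → Fin d} {p : Fin d × Fin d} :
    mods u p = 1 ↔ p.1 < p.2 ∧ u p.1 = p.2 := by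
  unfold mods
  split_ifs with h <;> simp [h]

/-- The total number of entries `p.2` in row `p.1`, where `p.1 < p.2`, in a family of column
fillings. -/
def content {X : Type*} [Fintype X] (A : X → Fin d → Fin d) (p : Fin d × Fin d) : ℕ :=
  ∑ c, mods (A c) p

open Classical in
/-- An entry of a column filling that differs from its row index, if there is one. -/
noncomputable def modOf (u : Fin d → Fin d) : Option (Fin d × Fin d) :=
  if h : ∃ p, mods u p = 1 then some h.choose else none

theorem mods_of_modOf {u : Fin d → Fin d} {p : Fin d × Fin d} (h : modOf u = some p) :
    mods u p = 1 := by
  unfold modOf at h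
  split_ifs at h with hex
  exact Option.some.inj h ▸ hex.choose_spec

theorem Simple.mods_eq {u w : Fin d → Fin d} (h : Simple u w) (p : Fin d × Fin d) :
    mods u p = if modOf u = some p then 1 else 0 := by
  split_ifs with hp
  · exact mods_of_modOf hp
  · by_contra hne
    have h1 : mods u p = 1 := le_antisymm (mods_le_one u p) (Nat.one_le_iff_ne_zero.2 hne)
    have hex : ∃ p, mods u p = 1 := ⟨p, h1⟩
    obtain ⟨q, hq⟩ : ∃ q, modOf u = some q := ⟨hex.choose, by simp [modOf, hex]⟩
    have h2 := mods_eq_one.1 (mods_of_modOf hq)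
    have h3 := mods_eq_one.1 h1
    have h4 : q.1 = p.1 := h.2 _ _ (h2.2 ▸ h2.1.ne') (h3.2 ▸ h3.1.ne')
    have h5 : q = p := Prod.ext h4 (by rw [← h2.2, ← h3.2, h4])
    exact hp (h5 ▸ hq)

open Classical in
/-- The columns at which a pair of fillings is not simple, with the fillings of these columns. -/
noncomputable def specialPart {X : Type*} (x : (X → Fin d → Fin d) × (X → Fin d → Fin d)) (c : X) :
    Option ((Fin d → Fin d) × (Fin d → Fin d)) :=
  if Simple (x.1 c) (x.2 c) then none else some (x.1 c, x.2 c)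

open Classical in
/-- The entries that differ from their row index in the columns at which a pair of fillings is
simple. -/
noncomputable def simplePart {X : Type*} (x : (X → Fin d → Fin d) × (X → Fin d → Fin d)) (c : X) :
    Option (Fin d × Fin d) :=
  if Simple (x.1 c) (x.2 c) then modOf (x.1 c) else none

theorem mods_fst_eq {X : Type*} (x : (X → Fin d → Fin d) × (X → Fin d → Fin d)) (c : X)
    (p : Fin d × Fin d) : mods (x.1 c) p
      = (if simplePart x c = some p then 1 else 0)
        + (specialPart x c).elim 0 fun y => mods y.1 p := by
  by_cases h : Simple (x.1 c) (x.2 c)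
  · simp [simplePart, specialPart, h, ← h.mods_eq]
  · simp [simplePart, specialPart, h]

theorem mods_snd_eq {X : Type*} (x : (X → Fin d → Fin d) × (X → Fin d → Fin d)) (c : X)
    (p : Fin d × Fin d) : mods (x.2 c) p
      = (if simplePart x c = some p then 1 else 0)
        + (specialPart x c).elim 0 fun y => mods y.2 p := by
  by_cases h : Simple (x.1 c) (x.2 c)
  · rw [← h.1, h.mods_eq]
    simp [simplePart, specialPart, h]
  · simp [simplePart, specialPart, h]

variable {X : Type*} [Fintype X]

/-- The content of the first components of a family of special columns. -/
def leftContent (s : X → Option ((Fin d → Fin d) × (Fin d → Fin d))) (p : Fin d × Fin d) : ℕ :=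
  ∑ c, (s c).elim 0 fun y => mods y.1 p

/-- The content of the second components of a family of special columns. -/
def rightContent (s : X → Option ((Fin d → Fin d) × (Fin d → Fin d))) (p : Fin d × Fin d) : ℕ :=
  ∑ c, (s c).elim 0 fun y => mods y.2 p

theorem content_fst (x : (X → Fin d → Fin d) × (X → Fin d → Fin d)) (p : Fin d × Fin d) :
    content x.1 p = #{c | simplePart x c = some p} + leftContent (specialPart x) p := by
  rw [content, leftContent, card_filter, ← sum_add_distrib]
  exact sum_congr rfl fun c _ => mods_fst_eq x c p

theorem content_snd (x : (X → Fin d → Fin d) × (X → Fin d → Fin d)) (p : Fin d × Fin d) :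
    content x.2 p = #{c | simplePart x c = some p} + rightContent (specialPart x) p := by
  rw [content, rightContent, card_filter, ← sum_add_distrib]
  exact sum_congr rfl fun c _ => mods_snd_eq x c p

theorem eq_of_parts_eq {x y : (X → Fin d → Fin d) × (X → Fin d → Fin d)}
    (hx : ∀ c i, i ≤ x.1 c i ∧ i ≤ x.2 c i) (hy : ∀ c i, i ≤ y.1 c i ∧ i ≤ y.2 c i)
    (h1 : specialPart x = specialPart y) (h2 : simplePart x = simplePart y) : x = y := by
  refine Prod.ext ?_ ?_ <;> funext c
  · refine mods_ext (fun i => (hx c i).1) (fun i => (hy c i).1) fun p => ?_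
    rw [mods_fst_eq, mods_fst_eq, h1, h2]
  · refine mods_ext (fun i => (hx c i).2) (fun i => (hy c i).2) fun p => ?_
    rw [mods_snd_eq, mods_snd_eq, h1, h2]

/-- In a simple column the only modified entry must be the exit. -/
theorem simplePart_mem_strip {lam : Fin d → ℕ}
    {x : (Fin (∑ i, lam i) → Fin d → Fin d) × (Fin (∑ i, lam i) → Fin d → Fin d)}
    (hx : ∀ c : Fin (∑ i, lam i), IsColumn lam c (x.1 c)) {c : Fin (∑ i, lam i)} {p : Fin d × Fin d}
    (h : simplePart x c = some p) : c ∈ strip lam p := by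
  unfold simplePart at h
  split_ifs at h with hs
  have h1 := mods_eq_one.1 (mods_of_modOf h)
  have hne : x.1 c p.1 ≠ p.1 := h1.2 ▸ h1.1.ne'
  obtain ⟨i, hi, hxi, hlt⟩ := (hx c).exists_exit fun hid => hne (by rw [hid]; rfl)
  have hip : i = p.1 := hs.2 _ _ hlt.ne' hne
  rw [mem_strip, ← h1.2, ← hip]
  exact ⟨hxi, hi⟩

/-- Geometric mean of two instances of `mass_le_mul_prod`, which is why the cost per entry is `z p =
√(N / D p)`. -/
theorem mass_le_sqrt_mul {P : Type*} [Fintype P] [DecidableEq P] {D r x y : P → ℕ} {N : ℝ}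
    (hx : ∀ p, x p ≠ 0 → D p ≠ 0) (hy : ∀ p, y p ≠ 0 → D p ≠ 0)
    (hxN : ∀ p, (r p + x p : ℝ) ≤ N) (hyN : ∀ p, (r p + y p : ℝ) ≤ N)
    {z : P → ℝ} (hz : ∀ p, 0 ≤ z p) (hzN : ∀ p, z p ^ 2 = N / D p) :
    mass D r ≤ √(mass D (r + x) * mass D (r + y)) * ((∏ p, z p ^ x p) * ∏ p, z p ^ y p) := by
  have hzx : 0 ≤ ∏ p, z p ^ x p := prod_nonneg fun p _ => pow_nonneg (hz p) _
  have hzy : 0 ≤ ∏ p, z p ^ y p := prod_nonneg fun p _ => pow_nonneg (hz p) _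
  have h1 := mass_le_mul_prod D r x hx hxN
  have h2 := mass_le_mul_prod D r y hy hyN
  have e : ∀ w : P → ℕ, ∏ p, (N / D p) ^ w p = (∏ p, z p ^ w p) ^ 2 := by
    intro w
    rw [← prod_pow]
    refine prod_congr rfl fun p _ => ?_
    rw [← hzN, ← pow_mul, ← pow_mul, mul_comm]
  rw [e] at h1 h2
  refine le_of_sq_le_sq ?_ (by positivity)
  rw [mul_pow, Real.sq_sqrt (mul_nonneg (mass_nonneg _ _) (mass_nonneg _ _))]
  calc mass D r ^ 2 = mass D r * mass D r := sq _
    _ ≤ (mass D (r + x) * (∏ p, z p ^ x p) ^ 2) * (mass D (r + y) * (∏ p, z p ^ y p) ^ 2) :=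
        mul_le_mul h1 h2 (mass_nonneg _ _) (mul_nonneg (mass_nonneg _ _) (sq_nonneg _))
    _ = _ := by ring

theorem prod_pow_leftContent (z : Fin d × Fin d → ℝ)
    (s : X → Option ((Fin d → Fin d) × (Fin d → Fin d))) :
    (∏ p, z p ^ leftContent s p) * (∏ p, z p ^ rightContent s p)
      = ∏ c, (s c).elim 1 (pairWeight z) := by
  simp only [leftContent, rightContent, ← prod_pow_eq_pow_sum]
  rw [prod_comm, prod_comm (s := univ (α := Fin d × Fin d)), ← prod_mul_distrib]
  refine prod_congr rfl fun c _ => ?_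
  cases s c <;> simp [pairWeight]

/-- The pairs are grouped by their special part `s`. Within a group the simple part is a marking of
content `r`, and it determines the pair, so `mass D r` bounds the group; `mass_le_sqrt_mul` turns
this into a product of pair weights. -/
theorem sum_linked_le {lam : Fin d → ℕ} (hlam : StrictAnti lam) {N : ℝ}
    {z : Fin d × Fin d → ℝ} (hz : ∀ p, 0 ≤ z p) (hzN : ∀ p, z p ^ 2 = N / #(strip lam p))
    {m : Fin d × Fin d → ℕ} (hm : ∀ p, (m p : ℝ) ≤ N)
    (T : Finset ((Fin (∑ i, lam i) → Fin d → Fin d) × (Fin (∑ i, lam i) → Fin d → Fin d)))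
    (hT : ∀ x ∈ T, (∀ c : Fin (∑ i, lam i), Linked lam c (x.1 c) (x.2 c)) ∧ x.1 ≠ x.2 ∧ content x.1 = m ∧
      ∀ p, (content x.2 p : ℝ) ≤ N) :
    ∑ x ∈ T, (√(mass (fun p => #(strip lam p)) m
        * mass (fun p => #(strip lam p)) (content x.2)))⁻¹
      ≤ ∏ c : Fin (∑ i, lam i), (1 + ∑ y ∈ specials lam c, pairWeight z y) - 1 := by
  classical
  set D : Fin d × Fin d → ℕ := fun p => #(strip lam p) with hD
  have hDpos : ∀ p : Fin d × Fin d, p.1 < p.2 → D p ≠ 0 := by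
    intro p hp
    have := hlam hp
    rw [hD]
    simp only [card_strip]
    omega
  have hmods : ∀ (u : Fin d → Fin d) p, mods u p ≠ 0 → D p ≠ 0 := fun u p hu =>
    hDpos p (mods_eq_one.1 (le_antisymm (mods_le_one u p) (Nat.one_le_iff_ne_zero.2 hu))).1
  have hleft : ∀ (s : Fin (∑ i, lam i) → Option ((Fin d → Fin d) × (Fin d → Fin d))) p,
      leftContent s p ≠ 0 → D p ≠ 0 := by
    intro s p hp
    obtain ⟨c, -, hc⟩ := exists_ne_zero_of_sum_ne_zero hp
    cases hs : s c with
    | none => simp [hs] at hc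
    | some y => exact hmods y.1 p (by simpa [hs] using hc)
  have hright : ∀ (s : Fin (∑ i, lam i) → Option ((Fin d → Fin d) × (Fin d → Fin d))) p,
      rightContent s p ≠ 0 → D p ≠ 0 := by
    intro s p hp
    obtain ⟨c, -, hc⟩ := exists_ne_zero_of_sum_ne_zero hp
    cases hs : s c with
    | none => simp [hs] at hc
    | some y => exact hmods y.2 p (by simpa [hs] using hc)
  have hcont : ∀ (A : Fin (∑ i, lam i) → Fin d → Fin d) p, content A p ≠ 0 → D p ≠ 0 := by
    intro A p hp
    obtain ⟨c, -, hc⟩ := exists_ne_zero_of_sum_ne_zero hp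
    exact hmods _ p hc
  -- `F` indexes the expansion of the product, `none` standing for the summand 1. The constant
  -- family `none` would force `x.1 = x.2`; its absence accounts for the `- 1`.
  set F : Finset (Fin (∑ i, lam i) → Option ((Fin d → Fin d) × (Fin d → Fin d))) :=
    Fintype.piFinset fun c => insertNone (specials lam c) with hF
  have hnone : (fun _ => none) ∈ F := by simp [hF]
  have hmaps : ∀ x ∈ T, specialPart x ∈ F.erase (fun _ => none) := by
    intro x hx
    obtain ⟨h1, h2, -, -⟩ := hT x hx
    rw [mem_erase]
    refine ⟨fun h => h2 (funext fun c => ?_), ?_⟩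
    · have := congrFun h c
      unfold specialPart at this
      split_ifs at this with hs
      exact hs.1
    · rw [hF, Fintype.mem_piFinset]
      intro c
      unfold specialPart
      split_ifs with hs
      · simp
      · simp [specials, h1 c, hs]
  have hfib : ∀ s ∈ F.erase (fun _ => none),
      ∑ x ∈ T with specialPart x = s, (√(mass D m * mass D (content x.2)))⁻¹
        ≤ ∏ c, (s c).elim 1 (pairWeight z) := by
    intro s _
    have hpos : 0 ≤ ∏ c, (s c).elim 1 (pairWeight z) := by
      refine prod_nonneg fun c _ => ?_
      cases s c
      · simp
      · exact pairWeight_nonneg hz _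
    rcases ({x ∈ T | specialPart x = s} : Finset _).eq_empty_or_nonempty with he | ⟨x₀, hx₀⟩
    · rw [he, sum_empty]
      exact hpos
    -- The subtraction does not truncate: the group contains `x₀`, whose left special content is
    -- part of `m`.
    set r : Fin d × Fin d → ℕ := fun p => m p - leftContent s p with hr
    have hcard : ∀ x ∈ T, specialPart x = s → ∀ p, #{c | simplePart x c = some p} = r p := by
      intro x hx hs p
      have h1 := content_fst x p
      rw [(hT x hx).2.2.1, hs] at h1
      change _ = m p - leftContent s p
      omega
    rw [mem_filter] at hx₀
    have hmr : m = r + leftContent s := by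
      funext p
      have h1 := content_fst x₀ p
      rw [(hT x₀ hx₀.1).2.2.1, hx₀.2, hcard x₀ hx₀.1 hx₀.2] at h1
      exact h1
    have hlr : ∀ x ∈ T, specialPart x = s → content x.2 = r + rightContent s := by
      intro x hx hs
      funext p
      rw [content_snd, hcard x hx hs, hs]
      rfl
    have hfcard : #{x ∈ T | specialPart x = s} ≤ #(markings (strip lam) r) := by
      refine card_le_card_of_injOn simplePart (fun x hx => ?_) fun x hx y hy hxy => ?_
      · rw [mem_coe, mem_filter] at hx
        rw [mem_coe, mem_markings]
        exact ⟨fun c p hc => simplePart_mem_strip (fun c => ((hT x hx.1).1 c).left) hc,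
          hcard x hx.1 hx.2⟩
      · rw [mem_coe, mem_filter] at hx hy
        refine eq_of_parts_eq (fun c i => ?_) (fun c i => ?_) (hx.2.trans hy.2.symm) hxy
        · exact ⟨((hT x hx.1).1 c).left.le i, ((hT x hx.1).1 c).right.le i⟩
        · exact ⟨((hT y hy.1).1 c).left.le i, ((hT y hy.1).1 c).right.le i⟩
    have hmm : 0 < mass D (r + leftContent s) := by
      rw [← hmr, ← (hT x₀ hx₀.1).2.2.1]
      exact mass_pos (hcont _)
    have hml : 0 < mass D (r + rightContent s) := by
      rw [← hlr x₀ hx₀.1 hx₀.2]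
      exact mass_pos (hcont _)
    have hsq : 0 < √(mass D (r + leftContent s) * mass D (r + rightContent s)) :=
      Real.sqrt_pos.2 (mul_pos hmm hml)
    calc ∑ x ∈ T with specialPart x = s, (√(mass D m * mass D (content x.2)))⁻¹
        = ∑ x ∈ T with specialPart x = s,
            (√(mass D (r + leftContent s) * mass D (r + rightContent s)))⁻¹ := by
          refine sum_congr rfl fun x hx => ?_
          rw [mem_filter] at hx
          rw [hlr x hx.1 hx.2, ← hmr]
      _ = #{x ∈ T | specialPart x = s}
            * (√(mass D (r + leftContent s) * mass D (r + rightContent s)))⁻¹ := by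
          rw [sum_const, nsmul_eq_mul]
      _ ≤ mass D r * (√(mass D (r + leftContent s) * mass D (r + rightContent s)))⁻¹ := by
          refine mul_le_mul_of_nonneg_right ?_ (inv_nonneg.2 hsq.le)
          exact (Nat.cast_le.2 hfcard).trans (card_markings_le _ _)
      _ ≤ (∏ p, z p ^ leftContent s p) * ∏ p, z p ^ rightContent s p := by
          rw [← div_eq_mul_inv, div_le_iff₀ hsq, mul_comm]
          refine mass_le_sqrt_mul (hleft s) (hright s) (fun p => ?_) (fun p => ?_) hz hzN
          · have := hm p
            rw [hmr] at this
            exact_mod_cast this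
          · have := (hT x₀ hx₀.1).2.2.2 p
            rw [hlr x₀ hx₀.1 hx₀.2] at this
            exact_mod_cast this
      _ = _ := prod_pow_leftContent z s
  rw [← sum_fiberwise_of_maps_to hmaps]
  refine (sum_le_sum hfib).trans ?_
  have h1 : ∏ c : Fin (∑ i, lam i), (1 + ∑ y ∈ specials lam c, pairWeight z y)
      = ∑ s ∈ F, ∏ c, (s c).elim 1 (pairWeight z) := by
    have h2 := prod_univ_sum (fun c : Fin (∑ i, lam i) => insertNone (specials lam c))
      fun _ o => o.elim 1 (pairWeight z)
    rw [hF, ← h2]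
    refine prod_congr rfl fun c _ => ?_
    rw [sum_insertNone]
    rfl
  rw [h1, ← add_sum_erase F _ hnone]
  simp

end Pairs

/-! ### Permutation operators -/

section PermOp

variable {d n : ℕ}

theorem permOp_mul (σ τ : Equiv.Perm (Fin n)) (x : TensorSpace d n) :
    permOp (σ * τ) x = permOp σ (permOp τ x) := rfl

theorem inner_permOp_left (τ : Equiv.Perm (Fin n)) (x y : TensorSpace d n) :
    inner ℂ (permOp τ x) y = inner ℂ x (permOp τ⁻¹ y) := by
  rw [PiLp.inner_apply, PiLp.inner_apply]
  refine Fintype.sum_equiv (Equiv.arrowCongr τ.symm (Equiv.refl _)) _ _ fun a => ?_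
  change inner ℂ (x (a ∘ τ)) (y a) = inner ℂ (x (a ∘ τ)) (y ((a ∘ τ) ∘ τ.symm))
  have h : (a ∘ τ) ∘ τ.symm = a := by
    funext k
    simp
  rw [h]

theorem inner_basisVec (a b : Fin n → Fin d) :
    inner ℂ (basisVec a) (basisVec b) = if b = a then (1 : ℂ) else 0 := by
  simp [basisVec, EuclideanSpace.inner_single_left, eq_comm]

end PermOp

/-! ### The Young symmetriser and its Gram matrix -/

section Symmetrisers

variable {d : ℕ} {lam : Fin d → ℕ}

theorem mem_rowPerms {σ : Equiv.Perm (Fin (∑ i, lam i))} :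
    σ ∈ rowPerms lam ↔ ∀ k, row lam (σ k) = row lam k := by simp [rowPerms]

theorem mem_colPerms {σ : Equiv.Perm (Fin (∑ i, lam i))} :
    σ ∈ colPerms lam ↔ ∀ k, col lam (σ k) = col lam k := by simp [colPerms]

theorem mul_mem_rowPerms {σ τ : Equiv.Perm (Fin (∑ i, lam i))} (hσ : σ ∈ rowPerms lam)
    (hτ : τ ∈ rowPerms lam) : σ * τ ∈ rowPerms lam :=
  mem_rowPerms.2 fun k => (mem_rowPerms.1 hσ _).trans (mem_rowPerms.1 hτ k)

theorem inv_mem_rowPerms {σ : Equiv.Perm (Fin (∑ i, lam i))} (hσ : σ ∈ rowPerms lam) :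
    σ⁻¹ ∈ rowPerms lam :=
  mem_rowPerms.2 fun k =>
    (mem_rowPerms.1 hσ (σ⁻¹ k)).symm.trans (congrArg _ (σ.apply_symm_apply k))

theorem one_mem_rowPerms : 1 ∈ rowPerms lam := mem_rowPerms.2 fun _ => rfl

theorem mul_mem_colPerms {σ τ : Equiv.Perm (Fin (∑ i, lam i))} (hσ : σ ∈ colPerms lam)
    (hτ : τ ∈ colPerms lam) : σ * τ ∈ colPerms lam :=
  mem_colPerms.2 fun k => (mem_colPerms.1 hσ _).trans (mem_colPerms.1 hτ k)

theorem inv_mem_colPerms {σ : Equiv.Perm (Fin (∑ i, lam i))} (hσ : σ ∈ colPerms lam) :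
    σ⁻¹ ∈ colPerms lam :=
  mem_colPerms.2 fun k =>
    (mem_colPerms.1 hσ (σ⁻¹ k)).symm.trans (congrArg _ (σ.apply_symm_apply k))

theorem one_mem_colPerms : 1 ∈ colPerms lam := mem_colPerms.2 fun _ => rfl

/-- The fillings obtained from `a` by permuting the entries within the rows. -/
def rowClass (lam : Fin d → ℕ) (a : Fin (∑ i, lam i) → Fin d) :
    Finset (Fin (∑ i, lam i) → Fin d) := (rowPerms lam).image fun σ : Equiv.Perm _ => a ∘ σ

theorem mem_rowClass {a b : Fin (∑ i, lam i) → Fin d} :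
    b ∈ rowClass lam a ↔ ∃ σ ∈ rowPerms lam, a ∘ σ = b := by simp [rowClass]

theorem self_mem_rowClass (a : Fin (∑ i, lam i) → Fin d) : a ∈ rowClass lam a :=
  mem_rowClass.2 ⟨1, one_mem_rowPerms, rfl⟩

theorem mem_rowClass_of_mem {a b c : Fin (∑ i, lam i) → Fin d} (ha : c ∈ rowClass lam a)
    (hb : c ∈ rowClass lam b) : b ∈ rowClass lam a := by
  obtain ⟨σ, hσ, rfl⟩ := mem_rowClass.1 ha
  obtain ⟨τ, hτ, h⟩ := mem_rowClass.1 hb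
  refine mem_rowClass.2 ⟨σ * τ⁻¹, mul_mem_rowPerms hσ (inv_mem_rowPerms hτ), ?_⟩
  funext k
  exact (congrFun h (τ⁻¹ k)).symm.trans (congrArg b (τ.apply_symm_apply k))

/-- The sum of the product basis vectors of a class of fillings. -/
noncomputable def rowVec (lam : Fin d → ℕ) (a : Fin (∑ i, lam i) → Fin d) : TensorSpace d (∑ i, lam i) :=
  ∑ b ∈ rowClass lam a, basisVec b

/-- Orbit-stabiliser: the row permutations sending `a` to a given member of its class form a coset
of the stabiliser, whose order is `s`. -/
theorem rowSym_basisVec (a : Fin (∑ i, lam i) → Fin d) :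
    ∃ s : ℝ, 0 < s ∧ rowSym lam (basisVec a) = (s : ℂ) • rowVec lam a := by
  refine ⟨#{σ ∈ rowPerms lam | a ∘ σ.symm = a}, ?_, ?_⟩
  · exact_mod_cast card_pos.2 ⟨1, by simpa using ⟨one_mem_rowPerms, rfl⟩⟩
  have hmaps : ∀ σ ∈ rowPerms lam, a ∘ σ.symm ∈ rowClass lam a := fun σ hσ =>
    mem_rowClass.2 ⟨σ⁻¹, inv_mem_rowPerms hσ, rfl⟩
  rw [rowSym, LinearMap.sum_apply]
  simp only [permOp_basisVec]
  rw [← sum_fiberwise_of_maps_to hmaps, rowVec, smul_sum]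
  refine sum_congr rfl fun b hb => ?_
  rw [sum_congr rfl (g := fun _ => basisVec b) fun σ hσ => by rw [(mem_filter.1 hσ).2], sum_const,
    ← Nat.cast_smul_eq_nsmul ℂ]
  congr 1
  obtain ⟨τ, hτ, rfl⟩ := mem_rowClass.1 hb
  norm_cast
  refine card_nbij' (fun σ => τ * σ) (fun σ => τ⁻¹ * σ) ?_ ?_ ?_ ?_
  · intro σ hσ
    simp only [coe_filter, Set.mem_ofPred_eq] at hσ ⊢
    refine ⟨mul_mem_rowPerms hτ hσ.1, ?_⟩
    funext k
    exact (congrFun hσ.2 (τ⁻¹ k)).trans (congrArg a (τ.apply_symm_apply k))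
  · intro σ hσ
    simp only [coe_filter, Set.mem_ofPred_eq] at hσ ⊢
    refine ⟨mul_mem_rowPerms (inv_mem_rowPerms hτ) hσ.1, ?_⟩
    funext k
    exact congrFun hσ.2 (τ k)
  · intro σ _
    simp
  · intro σ _
    simp

/-- The matrix coefficients of the column antisymmetriser. -/
def colSign (lam : Fin d → ℕ) (a b : Fin (∑ i, lam i) → Fin d) : ℤ :=
  ∑ τ ∈ colPerms lam, if b ∘ τ.symm = a then (Equiv.Perm.sign τ : ℤ) else 0

theorem inner_colAntisym_basisVec (a b : Fin (∑ i, lam i) → Fin d) :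
    inner ℂ (basisVec a) (colAntisym lam (basisVec b)) = (colSign lam a b : ℂ) := by
  rw [colAntisym, LinearMap.sum_apply, inner_sum, colSign, Int.cast_sum]
  refine sum_congr rfl fun τ _ => ?_
  rw [LinearMap.smul_apply, inner_smul_right, permOp_basisVec, inner_basisVec]
  split_ifs <;> simp

theorem colAntisym_apply (x : TensorSpace d (∑ i, lam i)) :
    colAntisym lam x
      = ∑ τ ∈ colPerms lam, ((Equiv.Perm.sign τ : ℤ) : ℂ) • permOp τ x := by
  rw [colAntisym, LinearMap.sum_apply]
  rfl

theorem permOp_colAntisym {σ : Equiv.Perm (Fin (∑ i, lam i))} (hσ : σ ∈ colPerms lam)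
    (x : TensorSpace d (∑ i, lam i)) :
    permOp σ (colAntisym lam x) = ((Equiv.Perm.sign σ : ℤ) : ℂ) • colAntisym lam x := by
  rw [colAntisym, LinearMap.sum_apply, map_sum, smul_sum]
  refine sum_nbij' (fun τ => σ * τ) (fun τ => σ⁻¹ * τ) (fun τ hτ => mul_mem_colPerms hσ hτ)
    (fun τ hτ => mul_mem_colPerms (inv_mem_colPerms hσ) hτ) (by simp) (by simp) fun τ _ => ?_
  rw [LinearMap.smul_apply, LinearMap.smul_apply, map_smul, permOp_mul, smul_smul,
    Equiv.Perm.sign_mul]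
  congr 1
  have : ((Equiv.Perm.sign σ : ℤ) : ℂ) * ((Equiv.Perm.sign σ : ℤ) : ℂ) = 1 := by
    rw [← Int.cast_mul, ← Units.val_mul, Int.units_mul_self]
    simp
  push_cast
  rw [← mul_assoc, this, one_mul]

/-- Each `τ` on the left moves to the right as `τ⁻¹`, where the antisymmetriser absorbs it with a
sign that cancels the one already present. -/
theorem inner_colAntisym_colAntisym (x y : TensorSpace d (∑ i, lam i)) :
    inner ℂ (colAntisym lam x) (colAntisym lam y)
      = (#(colPerms lam) : ℂ) * inner ℂ x (colAntisym lam y) := by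
  rw [colAntisym_apply x, sum_inner]
  rw [← nsmul_eq_mul, ← sum_const]
  refine sum_congr rfl fun τ hτ => ?_
  have : ((Equiv.Perm.sign τ : ℤ) : ℂ) * ((Equiv.Perm.sign τ : ℤ) : ℂ) = 1 := by
    rw [← Int.cast_mul, ← Units.val_mul, Int.units_mul_self]
    simp
  rw [inner_smul_left, inner_permOp_left,
    permOp_colAntisym (inv_mem_colPerms hτ), inner_smul_right, Equiv.Perm.sign_inv, ← mul_assoc,
    map_intCast, this, one_mul]

/-- The Gram matrix of the vectors `q_λ` applied to the sums over row classes, up to a factor. -/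
def gram (lam : Fin d → ℕ) (a b : Fin (∑ i, lam i) → Fin d) : ℤ :=
  ∑ x ∈ rowClass lam a, ∑ y ∈ rowClass lam b, colSign lam x y

theorem inner_colAntisym_rowVec (a b : Fin (∑ i, lam i) → Fin d) :
    inner ℂ (colAntisym lam (rowVec lam a)) (colAntisym lam (rowVec lam b))
      = (#(colPerms lam) : ℂ) * gram lam a b := by
  rw [inner_colAntisym_colAntisym, rowVec, rowVec, sum_inner, map_sum, gram]
  simp only [inner_sum, inner_colAntisym_basisVec]
  push_cast
  rfl

theorem norm_inner_normalised {E : Type*} [NormedAddCommGroup E] [InnerProductSpace ℂ E]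
    (x y : E) : ‖inner ℂ (((‖x‖⁻¹ : ℝ) : ℂ) • x) (((‖y‖⁻¹ : ℝ) : ℂ) • y)‖
      = ‖inner ℂ x y‖ / (‖x‖ * ‖y‖) := by
  rw [inner_smul_left, inner_smul_right, norm_mul, norm_mul, RCLike.norm_conj]
  simp only [Complex.norm_real, norm_inv, norm_norm]
  field_simp

theorem norm_inner_ket (m l : Tableau lam) :
    ‖inner ℂ m.ket l.ket‖
      = ‖inner ℂ (colAntisym lam (rowVec lam m.1)) (colAntisym lam (rowVec lam l.1))‖
        / (‖colAntisym lam (rowVec lam m.1)‖ * ‖colAntisym lam (rowVec lam l.1)‖) := by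
  obtain ⟨s, hs, hsm⟩ := rowSym_basisVec (lam := lam) m.1
  obtain ⟨t, ht, htl⟩ := rowSym_basisVec (lam := lam) l.1
  have hym : youngSym lam (basisVec m.1) = (s : ℂ) • colAntisym lam (rowVec lam m.1) := by
    rw [youngSym, LinearMap.comp_apply, hsm, map_smul]
  have hyl : youngSym lam (basisVec l.1) = (t : ℂ) • colAntisym lam (rowVec lam l.1) := by
    rw [youngSym, LinearMap.comp_apply, htl, map_smul]
  rw [Tableau.ket, Tableau.ket, norm_inner_normalised, hym, hyl, inner_smul_left,
    inner_smul_right, norm_mul, norm_mul, RCLike.norm_conj, norm_smul, norm_smul,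
    Complex.norm_real, Complex.norm_real, Real.norm_of_nonneg hs.le, Real.norm_of_nonneg ht.le,
    ← mul_assoc, mul_mul_mul_comm, mul_div_mul_left _ _ (mul_pos hs ht).ne']

theorem norm_colAntisym_rowVec_sq (a : Fin (∑ i, lam i) → Fin d) :
    ‖colAntisym lam (rowVec lam a)‖ ^ 2 = #(colPerms lam) * (gram lam a a : ℝ) := by
  have := inner_self_eq_norm_sq_to_K (𝕜 := ℂ) (colAntisym lam (rowVec lam a))
  rw [inner_colAntisym_rowVec] at this
  refine Complex.ofReal_injective ?_
  push_cast
  exact this.symm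

theorem div_le_of_sq_eq {q g A B β γ V W : ℝ} (hq : 0 < q) (hβ : 0 < β) (hγ : 0 < γ)
    (hg : 0 ≤ g) (hA : β / 2 ≤ A) (hB : γ / 2 ≤ B) (hV : 0 ≤ V) (hW : 0 ≤ W)
    (hVA : V ^ 2 = q * A) (hWB : W ^ 2 = q * B) :
    q * g / (V * W) ≤ 2 * (g * (√(β * γ))⁻¹) := by
  have hVpos : 0 < V := hV.lt_of_ne' (sq_pos_iff.1 (hVA ▸ mul_pos hq ((half_pos hβ).trans_le hA)))
  have hWpos : 0 < W := hW.lt_of_ne' (sq_pos_iff.1 (hWB ▸ mul_pos hq ((half_pos hγ).trans_le hB)))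
  have hlow : q * √(β * γ) ≤ 2 * (V * W) := by
    refine le_of_sq_le_sq ?_ (by positivity)
    rw [mul_pow, Real.sq_sqrt (by positivity), mul_pow, mul_pow, hVA, hWB]
    have h1 := mul_le_mul hA hB (half_pos hγ).le ((half_pos hβ).le.trans hA)
    have h2 := mul_le_mul_of_nonneg_left h1 (sq_nonneg q)
    linarith
  have hsq : 0 < √(β * γ) := Real.sqrt_pos.2 (mul_pos hβ hγ)
  rw [← div_eq_mul_inv, ← mul_div_assoc, div_le_div_iff₀ (by positivity) hsq]
  calc q * g * √(β * γ) = g * (q * √(β * γ)) := by ring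
    _ ≤ g * (2 * (V * W)) := mul_le_mul_of_nonneg_left hlow hg
    _ = _ := by ring

theorem norm_inner_ket_le (m l : Tableau lam) {β γ : ℝ} (hβ : 0 < β) (hγ : 0 < γ)
    (hm : β / 2 ≤ gram lam m.1 m.1) (hl : γ / 2 ≤ gram lam l.1 l.1) :
    ‖inner ℂ m.ket l.ket‖ ≤ 2 * (|(gram lam m.1 l.1 : ℝ)| * (√(β * γ))⁻¹) := by
  have hq : (0 : ℝ) < #(colPerms lam) := by
    exact_mod_cast card_pos.2 ⟨1, one_mem_colPerms⟩
  rw [norm_inner_ket, inner_colAntisym_rowVec, norm_mul, Complex.norm_natCast,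
    Complex.norm_intCast]
  exact div_le_of_sq_eq hq hβ hγ (abs_nonneg _) hm hl (norm_nonneg _) (norm_nonneg _)
    (norm_colAntisym_rowVec_sq _) (norm_colAntisym_rowVec_sq _)

/-- No column contains a value twice. -/
def ColInjective (lam : Fin d → ℕ) (a : Fin (∑ i, lam i) → Fin d) : Prop :=
  ∀ k l, col lam k = col lam l → a k = a l → k = l

/-- Composition with the transposition of two equal entries of a column pairs off terms of opposite
sign. -/
theorem colSign_eq_zero {a b : Fin (∑ i, lam i) → Fin d} (hb : ¬ ColInjective lam b) :
    colSign lam a b = 0 := by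
  unfold ColInjective at hb
  push Not at hb
  obtain ⟨k, l, hcol, hkl, hne⟩ := hb
  have hsw : Equiv.swap k l ∈ colPerms lam := mem_colPerms.2 fun x => by
    rcases eq_or_ne x k with rfl | hxk
    · rw [Equiv.swap_apply_left, hcol]
    rcases eq_or_ne x l with rfl | hxl
    · rw [Equiv.swap_apply_right, hcol]
    · rw [Equiv.swap_apply_of_ne_of_ne hxk hxl]
  have hb : b ∘ Equiv.swap k l = b := by
    funext x
    rcases eq_or_ne x k with rfl | hxk
    · simp [hkl]
    rcases eq_or_ne x l with rfl | hxl
    · simp [hkl]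
    · simp [Equiv.swap_apply_of_ne_of_ne hxk hxl]
  refine sum_involution (fun τ _ => τ * Equiv.swap k l) (fun τ _ => ?_) (fun τ _ _ => ?_)
    (fun τ hτ => mul_mem_colPerms hτ hsw) fun τ _ => ?_
  · have : b ∘ (τ * Equiv.swap k l).symm = b ∘ τ.symm := by
      conv_rhs => rw [← hb]
      rfl
    rw [this, Equiv.Perm.sign_mul, Equiv.Perm.sign_swap hne]
    split_ifs <;> simp
  · intro h
    exact hne (Equiv.swap_eq_one_iff.1 (mul_eq_left.1 h))
  · simp [mul_assoc]

theorem ColInjective.perm_unique {b : Fin (∑ i, lam i) → Fin d} (hb : ColInjective lam b)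
    {σ τ : Equiv.Perm (Fin (∑ i, lam i))} (hσ : σ ∈ colPerms lam) (hτ : τ ∈ colPerms lam)
    (h : b ∘ σ.symm = b ∘ τ.symm) : σ = τ := by
  have : σ⁻¹ = τ⁻¹ := Equiv.ext fun k => hb _ _
    ((mem_colPerms.1 (inv_mem_colPerms hσ) k).trans
      (mem_colPerms.1 (inv_mem_colPerms hτ) k).symm) (congrFun h k)
  exact inv_injective this

theorem ColInjective.colSign_eq {b : Fin (∑ i, lam i) → Fin d} (hb : ColInjective lam b)
    {τ : Equiv.Perm (Fin (∑ i, lam i))} (hτ : τ ∈ colPerms lam) :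
    colSign lam (b ∘ τ.symm) b = Equiv.Perm.sign τ := by
  rw [colSign, sum_eq_single_of_mem τ hτ, if_pos rfl]
  intro σ hσ hne
  rw [if_neg fun h => hne (hb.perm_unique hσ hτ h)]

theorem exists_of_colSign_ne_zero {a b : Fin (∑ i, lam i) → Fin d} (h : colSign lam a b ≠ 0) :
    ColInjective lam b ∧ ∃ τ ∈ colPerms lam, b ∘ τ.symm = a := by
  refine ⟨by_contra fun hb => h (colSign_eq_zero hb), ?_⟩
  obtain ⟨τ, hτ, hne⟩ := exists_ne_zero_of_sum_ne_zero h
  exact ⟨τ, hτ, by_contra fun hc => hne (if_neg hc)⟩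

theorem abs_colSign_le (a b : Fin (∑ i, lam i) → Fin d) : |colSign lam a b| ≤ 1 := by
  by_cases h : colSign lam a b = 0
  · simp [h]
  · obtain ⟨hb, τ, hτ, rfl⟩ := exists_of_colSign_ne_zero h
    rw [hb.colSign_eq hτ]
    rcases Int.units_eq_one_or (Equiv.Perm.sign τ) with h | h <;> simp [h]

theorem ColInjective.colSign_self {b : Fin (∑ i, lam i) → Fin d} (hb : ColInjective lam b) :
    colSign lam b b = 1 := by
  have := hb.colSign_eq one_mem_colPerms
  rw [Equiv.Perm.sign_one] at this
  exact this

end Symmetrisers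

/-! ### From fillings of the diagram to families of columns -/

section Boxes

variable {d : ℕ} {lam : Fin d → ℕ}

/-- The number of the box in row `i` and column `c`. -/
def boxAt (lam : Fin d → ℕ) (i : Fin d) (c : ℕ) (h : c < lam i) : Fin (∑ i, lam i) :=
  finSigmaFinEquiv ⟨i, ⟨c, h⟩⟩

theorem row_boxAt {i : Fin d} {c : ℕ} (h : c < lam i) : row lam (boxAt lam i c h) = i := by
  simp [row, box, boxAt]

theorem col_boxAt {i : Fin d} {c : ℕ} (h : c < lam i) : col lam (boxAt lam i c h) = c :=
  congrArg (fun x : (i : Fin d) × Fin (lam i) => (x.2 : ℕ))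
    (finSigmaFinEquiv.symm_apply_apply ⟨i, ⟨c, h⟩⟩)

theorem col_lt (k : Fin (∑ i, lam i)) : col lam k < lam (row lam k) := (box lam k).2.isLt

theorem boxAt_row_col (k : Fin (∑ i, lam i)) :
    boxAt lam (row lam k) (col lam k) (col_lt k) = k :=
  finSigmaFinEquiv.apply_symm_apply k

theorem box_ext {k l : Fin (∑ i, lam i)} (h1 : row lam k = row lam l)
    (h2 : col lam k = col lam l) : k = l := by
  have key : ∀ i i' c c' h h', i = i' → c = c' → boxAt lam i c h = boxAt lam i' c' h' := by
    rintro i _ c _ h h' rfl rfl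
    rfl
  rw [← boxAt_row_col k, ← boxAt_row_col l]
  exact key _ _ _ _ _ _ h1 h2

/-- The column of a box, as an element of the index set of all columns. -/
def colIdx (lam : Fin d → ℕ) (k : Fin (∑ i, lam i)) : Fin (∑ i, lam i) :=
  ⟨col lam k, (col_lt k).trans_le (le_sum_rows lam _)⟩

/-- The columns of a filling, extended by the row index outside of the diagram. -/
def toColumns (lam : Fin d → ℕ) (a : Fin (∑ i, lam i) → Fin d) (c : Fin (∑ i, lam i))
    (i : Fin d) : Fin d := if h : (c : ℕ) < lam i then a (boxAt lam i c h) else i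

theorem toColumns_of_lt (a : Fin (∑ i, lam i) → Fin d) {c : Fin (∑ i, lam i)} {i : Fin d}
    (h : (c : ℕ) < lam i) : toColumns lam a c i = a (boxAt lam i c h) := dif_pos h

theorem toColumns_of_le (a : Fin (∑ i, lam i) → Fin d) {c : Fin (∑ i, lam i)} {i : Fin d}
    (h : lam i ≤ c) : toColumns lam a c i = i := dif_neg (not_lt.2 h)

theorem toColumns_colIdx (a : Fin (∑ i, lam i) → Fin d) (k : Fin (∑ i, lam i)) :
    toColumns lam a (colIdx lam k) (row lam k) = a k := by
  rw [toColumns_of_lt a (c := colIdx lam k) (col_lt k)]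
  exact congrArg a (boxAt_row_col k)

theorem toColumns_injective : Function.Injective (toColumns lam) := fun a b h => by
  funext k
  rw [← toColumns_colIdx a, h, toColumns_colIdx]

/-- The number of entries `j` in row `i`. -/
def rowCount (lam : Fin d → ℕ) (a : Fin (∑ i, lam i) → Fin d) (i j : Fin d) : ℕ :=
  #{k | row lam k = i ∧ a k = j}

theorem card_row (i : Fin d) : #{k | row lam k = i} = lam i := by
  rw [← card_range (lam i)]
  refine card_bij' (fun k _ => col lam k)
    (fun c hc => boxAt lam i c (mem_range.1 hc)) ?_ ?_ ?_ ?_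
  · intro k hk
    simp only [mem_filter, mem_univ, true_and] at hk
    exact mem_range.2 (hk ▸ col_lt k)
  · intro c hc
    simp [row_boxAt]
  · intro k hk
    simp only [mem_filter, mem_univ, true_and] at hk
    exact box_ext ((row_boxAt _).trans hk.symm) (col_boxAt _)
  · intro c hc
    exact col_boxAt _

theorem sum_rowCount (a : Fin (∑ i, lam i) → Fin d) (i : Fin d) :
    ∑ j, rowCount lam a i j = lam i := by
  rw [← card_row (lam := lam) i, card_eq_sum_card_fiberwise (f := a) (t := univ) (by simp)]
  refine sum_congr rfl fun j _ => ?_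
  rw [rowCount, filter_filter]

theorem content_toColumns (a : Fin (∑ i, lam i) → Fin d) (p : Fin d × Fin d) :
    content (toColumns lam a) p = if p.1 < p.2 then rowCount lam a p.1 p.2 else 0 := by
  split_ifs with hp
  · have h1 : content (toColumns lam a) p = #{c | toColumns lam a c p.1 = p.2} := by
      rw [content, card_filter]
      exact sum_congr rfl fun c _ => by simp [mods, hp]
    have hlt : ∀ c : Fin (∑ i, lam i), toColumns lam a c p.1 = p.2 → (c : ℕ) < lam p.1 := by
      intro c hc
      by_contra hle
      rw [toColumns_of_le a (not_lt.1 hle)] at hc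
      exact hp.ne hc
    rw [h1, rowCount]
    refine card_bij' (fun c hc => boxAt lam p.1 c (hlt c (by simpa using hc)))
      (fun k _ => colIdx lam k) ?_ ?_ ?_ ?_
    · intro c hc
      simp only [mem_filter, mem_univ, true_and] at hc ⊢
      exact ⟨row_boxAt _, by rw [← toColumns_of_lt a]; exact hc⟩
    · intro k hk
      simp only [mem_filter, mem_univ, true_and] at hk ⊢
      rw [← hk.1, toColumns_colIdx, hk.2]
    · intro c hc
      exact Fin.ext (col_boxAt _)
    · intro k hk
      simp only [mem_filter, mem_univ, true_and] at hk
      exact box_ext ((row_boxAt _).trans hk.1.symm) (col_boxAt _)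
  · exact sum_eq_zero fun c _ => by simp [mods, hp]

theorem rowCount_of_mem {a b : Fin (∑ i, lam i) → Fin d} (h : b ∈ rowClass lam a) (i j : Fin d) :
    rowCount lam b i j = rowCount lam a i j := by
  obtain ⟨σ, hσ, rfl⟩ := mem_rowClass.1 h
  rw [rowCount, rowCount, ← card_map σ.toEmbedding]
  congr 1
  ext k
  simp only [mem_map_equiv, mem_filter, mem_univ, true_and, Function.comp_apply,
    Equiv.apply_symm_apply]
  rw [← mem_rowPerms.1 hσ, Equiv.apply_symm_apply]

/-- The maps (row, entry) of the two fillings have fibres of equal size; bijections between the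
fibres glue to a row permutation. -/
theorem mem_rowClass_of_rowCount {a b : Fin (∑ i, lam i) → Fin d}
    (h : ∀ i j, rowCount lam b i j = rowCount lam a i j) : b ∈ rowClass lam a := by
  have hcard : ∀ p : Fin d × Fin d, Fintype.card {k // (row lam k, b k) = p}
      = Fintype.card {k // (row lam k, a k) = p} := by
    rintro ⟨i, j⟩
    rw [Fintype.card_subtype, Fintype.card_subtype]
    simpa [rowCount] using h i j
  set σ : Equiv.Perm (Fin (∑ i, lam i)) :=
    Equiv.ofFiberEquiv fun p => Fintype.equivOfCardEq (hcard p) with hσ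
  have hσ2 : ∀ k, (row lam (σ k), a (σ k)) = (row lam k, b k) := fun k =>
    Equiv.ofFiberEquiv_map (fun p => Fintype.equivOfCardEq (hcard p)) k
  exact mem_rowClass.2 ⟨σ, mem_rowPerms.2 fun k => (Prod.ext_iff.1 (hσ2 k)).1,
    funext fun k => (Prod.ext_iff.1 (hσ2 k)).2⟩

theorem IsSemistandard.row_le (hlam : Antitone lam) {a : Fin (∑ i, lam i) → Fin d}
    (ha : IsSemistandard lam a) (k : Fin (∑ i, lam i)) : row lam k ≤ a k := by
  have key : ∀ i : ℕ, ∀ k, (row lam k : ℕ) = i → i ≤ a k := by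
    intro i
    induction i with
    | zero => exact fun k _ => Nat.zero_le _
    | succ i ih =>
      intro k hk
      have hi : i < d := by have := (row lam k).isLt; omega
      have hle : (⟨i, hi⟩ : Fin d) < row lam k := Fin.lt_def.2 (by simp [hk])
      have hc : col lam k < lam ⟨i, hi⟩ := (col_lt k).trans_le (hlam hle.le)
      have h1 := ih (boxAt lam ⟨i, hi⟩ _ hc) (by rw [row_boxAt])
      have h2 := ha.2 (boxAt lam ⟨i, hi⟩ _ hc) k (col_boxAt hc) (by rwa [row_boxAt])
      have h3 := Fin.lt_def.1 h2
      omega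
  exact Fin.le_def.2 (key _ k rfl)

theorem IsSemistandard.row_le_of_mem (hlam : Antitone lam) {a b : Fin (∑ i, lam i) → Fin d}
    (ha : IsSemistandard lam a) (hb : b ∈ rowClass lam a) (k : Fin (∑ i, lam i)) :
    row lam k ≤ b k := by
  obtain ⟨σ, hσ, rfl⟩ := mem_rowClass.1 hb
  rw [← mem_rowPerms.1 hσ k]
  exact ha.row_le hlam _

/-- If `a k < b k`, count the entries at most `a k` in the row of `k`: in `a` they fill at least the
columns up to that of `k`, in `b` only columns strictly before it. A row permutation preserves this
count. -/
theorem IsSemistandard.le_of_mem {a b : Fin (∑ i, lam i) → Fin d} (ha : IsSemistandard lam a)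
    (hb : IsSemistandard lam b) (hab : b ∈ rowClass lam a) (k : Fin (∑ i, lam i)) :
    b k ≤ a k := by
  by_contra! hlt
  obtain ⟨σ, hσ, rfl⟩ := mem_rowClass.1 hab
  have h1 : ({x | row lam x = row lam k ∧ col lam x ≤ col lam k} : Finset _)
      ⊆ ({x | row lam x = row lam k ∧ a x ≤ a k} : Finset _) := by
    intro x hx
    simp only [mem_filter, mem_univ, true_and] at hx ⊢
    exact ⟨hx.1, ha.1 x k hx.1 hx.2⟩
  have h2 : #({x | row lam x = row lam k ∧ (a ∘ σ) x ≤ a k} : Finset _)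
      = #({x | row lam x = row lam k ∧ a x ≤ a k} : Finset _) := by
    rw [← card_map σ.toEmbedding]
    congr 1
    ext x
    simp only [mem_map_equiv, mem_filter, mem_univ, true_and, Function.comp_apply,
      Equiv.apply_symm_apply]
    rw [← mem_rowPerms.1 hσ (σ.symm x), Equiv.apply_symm_apply]
  have h3 : ({x | row lam x = row lam k ∧ (a ∘ σ) x ≤ a k} : Finset _)
      ⊂ ({x | row lam x = row lam k ∧ col lam x ≤ col lam k} : Finset _) := by
    rw [ssubset_iff_of_subset]
    · exact ⟨k, by simp, by simpa using hlt⟩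
    · intro x hx
      simp only [mem_filter, mem_univ, true_and] at hx ⊢
      refine ⟨hx.1, ?_⟩
      by_contra! hcol
      exact absurd (hlt.trans_le (hb.1 k x hx.1.symm hcol.le)) (not_lt.2 hx.2)
  have h4 := card_lt_card h3
  have h5 := card_le_card h1
  omega

theorem Tableau.eq_of_mem {m l : Tableau lam} (h : l.1 ∈ rowClass lam m.1) : l = m := by
  refine Subtype.ext (funext fun k => le_antisymm (m.2.le_of_mem l.2 h k) ?_)
  exact l.2.le_of_mem m.2 (mem_rowClass_of_mem (self_mem_rowClass _) h) k

/-- A nonzero coefficient means that a column permutation carries `b`, which repeats no value in a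
column, to `a`; each column then keeps its set of values. -/
theorem linked_toColumns {a b : Fin (∑ i, lam i) → Fin d} (ha : ∀ k, row lam k ≤ a k)
    (hb : ∀ k, row lam k ≤ b k) (h : colSign lam a b ≠ 0) (c : Fin (∑ i, lam i)) :
    Linked lam c (toColumns lam a c) (toColumns lam b c) := by
  obtain ⟨hinj, τ, hτ, rfl⟩ := exists_of_colSign_ne_zero h
  have hτ' := mem_colPerms.1 (inv_mem_colPerms hτ)
  have hle : ∀ e : Fin (∑ i, lam i) → Fin d, (∀ k, row lam k ≤ e k) →
      ∀ i, i ≤ toColumns lam e c i := by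
    intro e he i
    by_cases hi : (c : ℕ) < lam i
    · rw [toColumns_of_lt e hi]
      exact (row_boxAt hi).symm.le.trans (he _)
    · rw [toColumns_of_le e (not_lt.1 hi)]
  have hio : ∀ e : Fin (∑ i, lam i) → Fin d, ColInjective lam e →
      Set.InjOn (toColumns lam e c) (rowsOf lam c) := by
    intro e he i hi j hj hij
    rw [mem_coe, mem_rowsOf] at hi hj
    rw [toColumns_of_lt e hi, toColumns_of_lt e hj] at hij
    have := he _ _ ((col_boxAt hi).trans (col_boxAt hj).symm) hij
    rw [← row_boxAt hi, this, row_boxAt hj]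
  have hinj' : ColInjective lam (b ∘ τ.symm) := fun k l hkl h =>
    τ.symm.injective (hinj _ _ ((hτ' k).trans (hkl.trans (hτ' l).symm)) h)
  have hsub : (rowsOf lam c).image (toColumns lam (b ∘ τ.symm) c)
      ⊆ (rowsOf lam c).image (toColumns lam b c) := by
    intro j hj
    obtain ⟨i, hi, rfl⟩ := mem_image.1 hj
    rw [mem_rowsOf] at hi
    rw [toColumns_of_lt _ hi]
    set k := τ.symm (boxAt lam i c hi) with hk
    have hkc : col lam k = c := (hτ' _).trans (col_boxAt hi)
    have hkc' : colIdx lam k = c := Fin.ext hkc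
    refine mem_image.2 ⟨row lam k, mem_rowsOf.2 (hkc ▸ col_lt k), ?_⟩
    have h2 := toColumns_colIdx b k
    rw [hkc'] at h2
    exact h2
  refine ⟨⟨hle _ ha, fun i hi => toColumns_of_le _ hi, hio _ hinj'⟩,
    ⟨hle _ hb, fun i hi => toColumns_of_le _ hi, hio _ hinj⟩, eq_of_subset_of_card_le hsub ?_⟩
  rw [card_image_of_injOn (hio _ hinj), card_image_of_injOn (hio _ hinj')]

/-- The filling with the entry `p.2` in row `p.1` of each column marked by `p`; all other entries
are equal to their row index. -/
def ofMarking (lam : Fin d → ℕ) (g : Fin (∑ i, lam i) → Option (Fin d × Fin d))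
    (k : Fin (∑ i, lam i)) : Fin d :=
  (g (colIdx lam k)).elim (row lam k) fun p => if p.1 = row lam k then p.2 else row lam k

variable {g : Fin (∑ i, lam i) → Option (Fin d × Fin d)}

theorem toColumns_ofMarking (hlam : Antitone lam) (hg : ∀ c p, g c = some p → c ∈ strip lam p)
    (c : Fin (∑ i, lam i)) (p : Fin d × Fin d) :
    mods (toColumns lam (ofMarking lam g) c) p = if g c = some p then 1 else 0 := by
  have hval : ∀ i, (c : ℕ) < lam i → toColumns lam (ofMarking lam g) c i
      = (g c).elim i fun q => if q.1 = i then q.2 else i := by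
    intro i hi
    rw [toColumns_of_lt _ hi, ofMarking]
    have : colIdx lam (boxAt lam i c hi) = c := Fin.ext (col_boxAt hi)
    rw [this, row_boxAt]
  split_ifs with h
  · have hs := mem_strip.1 (hg c p h)
    have hlt : p.1 < p.2 := by
      by_contra hle
      have := hlam (not_lt.1 hle)
      omega
    rw [mods_eq_one]
    refine ⟨hlt, ?_⟩
    rw [hval _ hs.2, h]
    simp
  · by_contra hne
    obtain ⟨hlt, hp⟩ := mods_eq_one.1
      (le_antisymm (mods_le_one _ p) (Nat.one_le_iff_ne_zero.2 hne))
    by_cases hi : (c : ℕ) < lam p.1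
    · rw [hval _ hi] at hp
      cases hgc : g c with
      | none => simp [hgc, hlt.ne] at hp
      | some q =>
        simp only [hgc, Option.elim_some] at hp
        split_ifs at hp with hq
        · exact h (by rw [hgc, Prod.ext hq hp])
        · exact hlt.ne hp
    · rw [toColumns_of_le _ (not_lt.1 hi)] at hp
      exact hlt.ne hp

theorem row_le_ofMarking (hlam : Antitone lam) (hg : ∀ c p, g c = some p → c ∈ strip lam p)
    (k : Fin (∑ i, lam i)) : row lam k ≤ ofMarking lam g k := by
  unfold ofMarking
  cases h : g (colIdx lam k) with
  | none => simp
  | some p =>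
    simp only [Option.elim_some]
    split_ifs with hp
    · rw [← hp]
      by_contra hle
      have := hlam (not_le.1 hle).le
      have := mem_strip.1 (hg _ p h)
      omega
    · exact le_rfl

theorem colInjective_ofMarking (hg : ∀ c p, g c = some p → c ∈ strip lam p) :
    ColInjective lam (ofMarking lam g) := by
  intro k l hkl h
  have hidx : colIdx lam k = colIdx lam l := Fin.ext hkl
  refine box_ext ?_ hkl
  unfold ofMarking at h
  rw [hidx] at h
  cases hgc : g (colIdx lam l) with
  | none => simpa [hgc] using h
  | some p =>
    have hs := (mem_strip.1 (hg _ p hgc)).1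
    have hl : p.2 ≠ row lam l := fun he => by
      rw [he] at hs
      exact absurd (col_lt l) (not_lt.2 hs)
    have hk : p.2 ≠ row lam k := fun he => by
      rw [he, ← hidx] at hs
      exact absurd (col_lt k) (not_lt.2 hs)
    simp only [hgc, Option.elim_some] at h
    split_ifs at h with h1 h2 h2
    · exact h1.symm.trans h2
    · exact absurd h hl
    · exact absurd h.symm hk
    · exact h

/-- A marked column receives a single new value, the index of a row it does not meet, so no value is
repeated and the diagonal coefficient is 1. -/
theorem card_markings_le_card_colInjective (hlam : Antitone lam)
    {a : Fin (∑ i, lam i) → Fin d} (ha : IsSemistandard lam a) :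
    #(markings (strip lam) (content (toColumns lam a)))
      ≤ ∑ b ∈ rowClass lam a, if colSign lam b b = 1 then 1 else 0 := by
  rw [← card_filter]
  refine card_le_card_of_injOn (ofMarking lam) (fun g hg => ?_) fun g hg g' hg' h => ?_
  · rw [mem_coe, mem_markings] at hg
    rw [mem_coe, mem_filter]
    refine ⟨mem_rowClass_of_rowCount ?_, (colInjective_ofMarking hg.1).colSign_self⟩
    have hne : ∀ i j, i ≠ j → rowCount lam (ofMarking lam g) i j = rowCount lam a i j := by
      intro i j hij
      rcases hij.lt_or_gt with hlt | hgt
      · have h1 := content_toColumns (ofMarking lam g) (i, j)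
        have h2 := content_toColumns a (i, j)
        rw [if_pos hlt] at h1 h2
        rw [← h1, ← h2, ← hg.2, content, card_filter]
        exact sum_congr rfl fun c _ => toColumns_ofMarking hlam hg.1 c _
      · have hz : ∀ e : Fin (∑ i, lam i) → Fin d, (∀ k, row lam k ≤ e k) →
            rowCount lam e i j = 0 := by
          intro e he
          rw [rowCount, card_eq_zero, filter_eq_empty_iff]
          rintro k - ⟨rfl, rfl⟩
          exact absurd (he k) (not_le.2 hgt)
        rw [hz _ (row_le_ofMarking hlam hg.1), hz _ (ha.row_le hlam)]
    -- The multiplicity of `i` in row `i` is what the other entries leave of the row length.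
    intro i j
    rcases eq_or_ne i j with rfl | hij
    · have h1 := sum_rowCount (ofMarking lam g) i
      rw [← sum_rowCount a i, ← add_sum_erase _ _ (mem_univ i),
        ← add_sum_erase _ _ (mem_univ i), sum_congr rfl fun j hj =>
          hne i j (ne_of_mem_erase hj).symm] at h1
      exact Nat.add_right_cancel h1
    · exact hne i j hij
  · rw [mem_coe, mem_markings] at hg hg'
    funext c
    have key : ∀ p, g c = some p ↔ g' c = some p := by
      intro p
      have h1 := toColumns_ofMarking hlam hg.1 c p
      rw [h, toColumns_ofMarking hlam hg'.1 c p] at h1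
      by_cases h2 : g c = some p <;> by_cases h3 : g' c = some p <;> simp_all
    exact Option.ext key

end Boxes

/-! ### Bounds for the Gram matrix and the overlaps -/

section Overlaps

variable {d : ℕ} {lam : Fin d → ℕ}

theorem sum_content_toColumns (m : Tableau lam) :
    ∑ p, content (toColumns lam m.1) p = m.total := by
  rw [Fintype.sum_prod_type, Tableau.total]
  refine sum_congr rfl fun i _ => ?_
  simp only [content_toColumns]
  rw [← sum_filter]
  refine sum_congr ?_ fun j _ => rfl
  ext j
  simp

theorem content_toColumns_le_total (m : Tableau lam) (p : Fin d × Fin d) :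
    content (toColumns lam m.1) p ≤ m.total := by
  rw [← sum_content_toColumns]
  exact single_le_sum (fun _ _ => Nat.zero_le _) (mem_univ p)

theorem content_eq_of_mem {a b : Fin (∑ i, lam i) → Fin d} (h : b ∈ rowClass lam a) :
    content (toColumns lam b) = content (toColumns lam a) := by
  funext p
  rw [content_toColumns, content_toColumns, rowCount_of_mem h]

theorem Tableau.eq_row_of_total_eq_zero (hlam : Antitone lam) {m : Tableau lam}
    (h : m.total = 0) : m.1 = row lam := by
  funext k
  refine le_antisymm ?_ (m.2.row_le hlam k)
  by_contra! hlt
  have h1 := Nat.le_zero.1 (h ▸ content_toColumns_le_total m (row lam k, m.1 k))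
  rw [content_toColumns, if_pos hlt, rowCount, card_eq_zero, filter_eq_empty_iff] at h1
  exact h1 (mem_univ k) ⟨rfl, rfl⟩

/-- The approximate squared norm of `y_λ f_m`, up to a factor that does not depend on `m`. -/
noncomputable def Tableau.mass (m : Tableau lam) : ℝ :=
  YoungOverlap.mass (fun p => #(strip lam p)) (content (toColumns lam m.1))

theorem Tableau.mass_pos (hlam : StrictAnti lam) (m : Tableau lam) : 0 < m.mass := by
  refine YoungOverlap.mass_pos fun p hp => ?_
  rw [content_toColumns] at hp
  have : p.1 < p.2 := by
    by_contra h
    exact hp (if_neg h)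
  have := hlam this
  rw [card_strip]
  omega

/-- The sum of the moduli of the off-diagonal coefficients that contribute to `gram`. -/
def offGram (lam : Fin d → ℕ) (a b : Fin (∑ i, lam i) → Fin d) : ℤ :=
  ∑ x ∈ rowClass lam a, ∑ y ∈ rowClass lam b, if x = y then 0 else |colSign lam x y|

theorem offGram_nonneg (a b : Fin (∑ i, lam i) → Fin d) : 0 ≤ offGram lam a b :=
  sum_nonneg fun _ _ => sum_nonneg fun _ _ => by
    split_ifs
    exacts [le_rfl, abs_nonneg _]

theorem abs_gram_le_offGram {m l : Tableau lam} (h : l ≠ m) :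
    |gram lam m.1 l.1| ≤ offGram lam m.1 l.1 := by
  refine (abs_sum_le_sum_abs _ _).trans (sum_le_sum fun x hx => ?_)
  refine (abs_sum_le_sum_abs _ _).trans (sum_le_sum fun y hy => ?_)
  rw [if_neg]
  rintro rfl
  exact h (Tableau.eq_of_mem (mem_rowClass_of_mem hx hy))

theorem sum_diag_sub_offGram_le (a : Fin (∑ i, lam i) → Fin d) :
    (∑ b ∈ rowClass lam a, if colSign lam b b = 1 then 1 else 0) - offGram lam a a
      ≤ gram lam a a := by
  rw [gram, offGram, ← sum_sub_distrib]
  refine sum_le_sum fun x hx => ?_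
  rw [← add_sum_erase _ _ hx, ← add_sum_erase _ _ hx, if_pos rfl, zero_add]
  have h1 : -∑ y ∈ (rowClass lam a).erase x, (if x = y then 0 else |colSign lam x y|)
      ≤ ∑ y ∈ (rowClass lam a).erase x, colSign lam x y := by
    rw [← sum_neg_distrib]
    refine sum_le_sum fun y hy => ?_
    rw [if_neg (ne_of_mem_erase hy).symm]
    exact neg_abs_le _
  have h2 : (if colSign lam x x = 1 then 1 else 0) ≤ colSign lam x x := by
    split_ifs with h
    · exact h.ge
    · by_cases hx : ColInjective lam x
      · exact absurd hx.colSign_self h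
      · exact (colSign_eq_zero hx).ge
  linarith

theorem offGram_le_card (m l : Tableau lam) : offGram lam m.1 l.1
    ≤ #{x ∈ rowClass lam m.1 ×ˢ rowClass lam l.1 | x.1 ≠ x.2 ∧ colSign lam x.1 x.2 ≠ 0} := by
  rw [offGram, ← sum_product', card_filter, Nat.cast_sum]
  refine sum_le_sum fun x _ => ?_
  by_cases h1 : x.1 = x.2
  · simp [h1]
  by_cases h2 : colSign lam x.1 x.2 = 0
  · simp [h1, h2]
  · simpa [h1, h2] using abs_colSign_le x.1 x.2

/-- The pairs for different `l` are disjoint, because a row class contains at most one semistandard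
filling; one application of `sum_linked_le` thus handles all `l` together. The term `l = m` is kept
for the diagonal estimate. -/
theorem sum_offGram_le (hlam : StrictAnti lam) {N : ℝ} {z : Fin d × Fin d → ℝ}
    (hz : ∀ p, 0 ≤ z p) (hzN : ∀ p, z p ^ 2 = N / #(strip lam p)) (m : Tableau lam)
    (hm : (m.total : ℝ) ≤ N) :
    ∑ l : Tableau lam with (l.total : ℝ) ≤ N, offGram lam m.1 l.1 * (√(m.mass * l.mass))⁻¹
      ≤ ∏ c : Fin (∑ i, lam i), (1 + ∑ y ∈ specials lam c, pairWeight z y) - 1 := by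
  classical
  set L : Finset (Tableau lam) := {l | (l.total : ℝ) ≤ N} with hL
  set P : Tableau lam → Finset ((Fin (∑ i, lam i) → Fin d) × (Fin (∑ i, lam i) → Fin d)) :=
    fun l => {x ∈ rowClass lam m.1 ×ˢ rowClass lam l.1 | x.1 ≠ x.2 ∧ colSign lam x.1 x.2 ≠ 0}
    with hP
  have hPm : ∀ l x, x ∈ P l ↔ (x.1 ∈ rowClass lam m.1 ∧ x.2 ∈ rowClass lam l.1) ∧
      x.1 ≠ x.2 ∧ colSign lam x.1 x.2 ≠ 0 := by
    intro l x
    simp [hP]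
  set f : (Σ _ : Tableau lam, (Fin (∑ i, lam i) → Fin d) × (Fin (∑ i, lam i) → Fin d)) →
      (Fin (∑ i, lam i) → Fin d → Fin d) × (Fin (∑ i, lam i) → Fin d → Fin d) :=
    fun x => (toColumns lam x.2.1, toColumns lam x.2.2) with hf
  have hinj : Set.InjOn f (L.sigma P) := by
    rintro ⟨l, a, b⟩ hx ⟨l', a', b'⟩ hx' h
    rw [mem_coe, mem_sigma, hPm] at hx hx'
    obtain rfl : a = a' := toColumns_injective (Prod.ext_iff.1 h).1
    obtain rfl : b = b' := toColumns_injective (Prod.ext_iff.1 h).2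
    obtain rfl := Tableau.eq_of_mem (mem_rowClass_of_mem hx.2.1.2 hx'.2.1.2)
    rfl
  have key := sum_linked_le hlam hz hzN (m := content (toColumns lam m.1))
    (fun p => (Nat.cast_le.2 (content_toColumns_le_total m p)).trans hm)
    ((L.sigma P).image f) (by
      intro x hx
      obtain ⟨⟨l, a, b⟩, hy, rfl⟩ := mem_image.1 hx
      rw [mem_sigma, hPm] at hy
      obtain ⟨hl, ⟨ha, hb⟩, hne, hs⟩ := hy
      dsimp only at hl ha hb hne hs
      refine ⟨linked_toColumns (m.2.row_le_of_mem hlam.antitone ha)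
        (l.2.row_le_of_mem hlam.antitone hb) hs, fun h => hne (toColumns_injective h),
        content_eq_of_mem ha, fun p => ?_⟩
      rw [hf]
      dsimp only
      rw [content_eq_of_mem hb]
      exact (Nat.cast_le.2 (content_toColumns_le_total l p)).trans (mem_filter.1 hl).2)
  rw [sum_image hinj, sum_sigma] at key
  refine le_trans (sum_le_sum fun l hl => ?_) key
  have h1 : ∀ x ∈ P l, (√(YoungOverlap.mass (fun p => #(strip lam p))
      (content (toColumns lam m.1)) * YoungOverlap.mass (fun p => #(strip lam p))
      (content (f ⟨l, x⟩).2)))⁻¹ = (√(m.mass * l.mass))⁻¹ := by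
    intro x hx
    rw [hf]
    dsimp only
    rw [content_eq_of_mem ((hPm l x).1 hx).1.2]
    rfl
  rw [sum_congr rfl h1, sum_const, nsmul_eq_mul]
  refine mul_le_mul_of_nonneg_right ?_ (by positivity)
  exact_mod_cast offGram_le_card m l

theorem prod_one_add_le_exp {ι : Type*} (s : Finset ι) {f : ι → ℝ} (hf : ∀ i ∈ s, 0 ≤ f i) :
    ∏ i ∈ s, (1 + f i) ≤ Real.exp (∑ i ∈ s, f i) := by
  rw [Real.exp_sum]
  refine prod_le_prod (fun i hi => add_nonneg zero_le_one (hf i hi)) fun i _ => ?_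
  rw [add_comm]
  exact Real.add_one_le_exp _

variable {N t : ℝ}

/-- The product over columns is at most `exp X`, and `exp X - 1 ≤ 2 * X` for `0 ≤ X ≤ 1`. -/
theorem sum_offGram_le_two_mul (hN : 1 ≤ N) (ht : 0 < t)
    (hgap : ∀ i j, i < j → t < (lam i : ℝ) - lam j) (hNt : N ^ 2 / t ≤ 1 / 4)
    (hX : ((d : ℝ) ^ d) ^ 2 * (√(N / t) * (d ^ 2 * N)) ≤ 1) (m : Tableau lam)
    (hm : (m.total : ℝ) ≤ N) :
    ∑ l : Tableau lam with (l.total : ℝ) ≤ N, offGram lam m.1 l.1 * (√(m.mass * l.mass))⁻¹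
      ≤ 2 * (((d : ℝ) ^ d) ^ 2 * (√(N / t) * (d ^ 2 * N))) := by
  have hN0 : 0 < N := zero_lt_one.trans_le hN
  have hlam : StrictAnti lam := fun i j hij => by
    have := hgap i j hij
    exact_mod_cast (by linarith : (lam j : ℝ) < lam i)
  set z : Fin d × Fin d → ℝ := fun p => √(N / #(strip lam p)) with hz
  have hzN : ∀ p, z p ^ 2 = N / #(strip lam p) := fun p => Real.sq_sqrt (by positivity)
  have hκ1 : √(N / t) ≤ 1 := by
    refine Real.sqrt_le_one.2 (le_trans ?_ (hNt.trans (by norm_num)))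
    gcongr
    nlinarith
  have hzκ : ∀ p : Fin d × Fin d, p.1 < p.2 → z p ≤ √(N / t) := by
    intro p hp
    refine Real.sqrt_le_sqrt (div_le_div_of_nonneg_left hN0.le ht ?_)
    rw [card_strip, Nat.cast_sub (hlam hp).le]
    exact (hgap _ _ hp).le
  have h0 : ∀ p, 0 ≤ z p := fun p => Real.sqrt_nonneg _
  have h1 := sum_offGram_le hlam h0 hzN m hm
  have h2 := sum_pairWeight_le lam hN0.le (Real.sqrt_nonneg (N / t)) h0 hzN
    (fun p hp => (hzκ p hp).trans hκ1) hzκ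
  have h3 := prod_one_add_le_exp univ (f := fun c : Fin (∑ i, lam i) =>
    ∑ y ∈ specials lam c, pairWeight z y)
    fun c _ => sum_nonneg fun y _ => pairWeight_nonneg h0 y
  have h4 := Real.exp_le_exp.2 h2
  have hX0 : 0 ≤ ((d : ℝ) ^ d) ^ 2 * (√(N / t) * (d ^ 2 * N)) := by positivity
  have h5 := Real.abs_exp_sub_one_le (x := ((d : ℝ) ^ d) ^ 2 * (√(N / t) * (d ^ 2 * N)))
    (by rwa [abs_of_nonneg hX0])
  rw [abs_of_nonneg hX0] at h5
  have h6 := (le_abs_self _).trans h5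
  linarith

/-- Bernoulli's inequality gives at least `(1 - N²/t) * mass ≥ 3/4 * mass` diagonal terms equal to
1; the off-diagonal ones remove at most `2 * (1/8) * mass`. -/
theorem half_mass_le_gram (hN : 1 ≤ N) (ht : 0 < t)
    (hgap : ∀ i j, i < j → t < (lam i : ℝ) - lam j) (hNt : N ^ 2 / t ≤ 1 / 4)
    (hX : ((d : ℝ) ^ d) ^ 2 * (√(N / t) * (d ^ 2 * N)) ≤ 1 / 8) (m : Tableau lam)
    (hm : (m.total : ℝ) ≤ N) : m.mass / 2 ≤ gram lam m.1 m.1 := by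
  have hN0 : 0 < N := zero_lt_one.trans_le hN
  have hlam : StrictAnti lam := fun i j hij => by
    have := hgap i j hij
    exact_mod_cast (by linarith : (lam j : ℝ) < lam i)
  have hmass := m.mass_pos hlam
  have hoff : (offGram lam m.1 m.1 : ℝ) ≤ m.mass / 4 := by
    have h1 := sum_offGram_le_two_mul hN ht hgap hNt (hX.trans (by norm_num)) m hm
    have h2 := single_le_sum (s := ({l | (l.total : ℝ) ≤ N} : Finset (Tableau lam)))
      (f := fun l => (offGram lam m.1 l.1 : ℝ) * (√(m.mass * l.mass))⁻¹)
      (fun l _ => mul_nonneg (Int.cast_nonneg (offGram_nonneg _ _)) (by positivity))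
      (mem_filter.2 ⟨mem_univ m, hm⟩)
    rw [Real.sqrt_mul_self hmass.le] at h2
    have h3 : (offGram lam m.1 m.1 : ℝ) * m.mass⁻¹ ≤ 1 / 4 := by linarith
    rw [← div_eq_mul_inv, div_le_iff₀ hmass] at h3
    linarith
  have hNt1 : N / t ≤ 1 / 4 := by
    refine le_trans ?_ hNt
    gcongr
    nlinarith
  have hdiag : 3 / 4 * m.mass ≤ #(markings (strip lam) (content (toColumns lam m.1))) := by
    have hsum : ((∑ p, content (toColumns lam m.1) p : ℕ) : ℝ) ≤ N := by
      rwa [sum_content_toColumns]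
    have h1 := le_card_markings (S := strip lam) (θ := 1 - N / t) (N := N) (by linarith)
      (content (toColumns lam m.1)) (fun p hp => ?_) hsum
    · refine le_trans (mul_le_mul_of_nonneg_right ?_ hmass.le) h1
      have h2 := one_add_mul_le_pow (a := -(N / t)) (by linarith)
        (∑ p, content (toColumns lam m.1) p)
      rw [← sub_eq_add_neg] at h2
      refine le_trans ?_ h2
      have h3 : ((∑ p, content (toColumns lam m.1) p : ℕ) : ℝ) * (N / t) ≤ N ^ 2 / t := by
        rw [sq, mul_div_assoc]
        gcongr
      linarith
    · rw [content_toColumns] at hp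
      have hlt : p.1 < p.2 := by
        by_contra h
        exact hp (if_neg h)
      have hD : t ≤ #(strip lam p) := by
        rw [card_strip, Nat.cast_sub (hlam hlt).le]
        exact (hgap _ _ hlt).le
      have : N ≤ N / t * #(strip lam p) := by
        rw [div_mul_eq_mul_div, le_div_iff₀ ht]
        gcongr
      linarith
  have h1 : ((∑ b ∈ rowClass lam m.1, if colSign lam b b = 1 then 1 else 0 : ℤ) : ℝ)
      - offGram lam m.1 m.1 ≤ gram lam m.1 m.1 := by
    exact_mod_cast sum_diag_sub_offGram_le m.1
  have h2 : (#(markings (strip lam) (content (toColumns lam m.1))) : ℝ)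
      ≤ ((∑ b ∈ rowClass lam m.1, if colSign lam b b = 1 then 1 else 0 : ℤ) : ℝ) := by
    exact_mod_cast card_markings_le_card_colInjective hlam.antitone m.2
  linarith

theorem sum_norm_inner_ket_le (hN : 1 ≤ N) (ht : 0 < t)
    (hgap : ∀ i j, i < j → t < (lam i : ℝ) - lam j) (hNt : N ^ 2 / t ≤ 1 / 4)
    (hX : ((d : ℝ) ^ d) ^ 2 * (√(N / t) * (d ^ 2 * N)) ≤ 1 / 8) (m : Tableau lam)
    (hm : (m.total : ℝ) ≤ N) :
    ∑ l : Tableau lam with l ≠ m ∧ (l.total : ℝ) ≤ N, ‖inner ℂ m.ket l.ket‖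
      ≤ 4 * (((d : ℝ) ^ d) ^ 2 * (√(N / t) * (d ^ 2 * N))) := by
  have hlam : StrictAnti lam := fun i j hij => by
    have := hgap i j hij
    exact_mod_cast (by linarith : (lam j : ℝ) < lam i)
  have h1 := sum_offGram_le_two_mul hN ht hgap hNt (hX.trans (by norm_num)) m hm
  have h2 : ∑ l : Tableau lam with l ≠ m ∧ (l.total : ℝ) ≤ N, ‖inner ℂ m.ket l.ket‖
      ≤ ∑ l : Tableau lam with l ≠ m ∧ (l.total : ℝ) ≤ N,
        2 * (offGram lam m.1 l.1 * (√(m.mass * l.mass))⁻¹) := by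
    refine sum_le_sum fun l hl => ?_
    simp only [mem_filter, mem_univ, true_and] at hl
    refine (norm_inner_ket_le m l (m.mass_pos hlam) (l.mass_pos hlam)
      (half_mass_le_gram hN ht hgap hNt hX m hm)
      (half_mass_le_gram hN ht hgap hNt hX l hl.2)).trans ?_
    have : |(gram lam m.1 l.1 : ℝ)| ≤ offGram lam m.1 l.1 := by
      exact_mod_cast abs_gram_le_offGram hl.1
    gcongr
  have h3 : ∑ l : Tableau lam with l ≠ m ∧ (l.total : ℝ) ≤ N,
        2 * ((offGram lam m.1 l.1 : ℝ) * (√(m.mass * l.mass))⁻¹)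
      ≤ ∑ l : Tableau lam with (l.total : ℝ) ≤ N,
        2 * ((offGram lam m.1 l.1 : ℝ) * (√(m.mass * l.mass))⁻¹) := by
    refine sum_le_sum_of_subset_of_nonneg (fun l hl => ?_) fun l _ _ => ?_
    · simp only [mem_filter, mem_univ, true_and] at hl ⊢
      exact hl.2
    · exact mul_nonneg zero_le_two
        (mul_nonneg (Int.cast_nonneg (offGram_nonneg _ _)) (by positivity))
  simp only [← mul_sum] at h2 h3
  linarith

end Overlaps

/-! ### Choice of parameters and exponents -/

section Bounds

variable {d n : ℕ} {lam : Fin d → ℕ} {δ : ℝ}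

theorem gap_of_adjacent (hanti : Antitone lam)
    (hadj : ∀ i j : Fin d, (j : ℕ) = (i : ℕ) + 1 → δ * n < (lam i : ℝ) - (lam j : ℝ))
    (i j : Fin d) (hij : i < j) : δ * n < (lam i : ℝ) - lam j := by
  have hlt := Fin.lt_def.1 hij
  have hi : (i : ℕ) + 1 < d := by have := j.isLt; omega
  have h1 := hadj i ⟨i + 1, hi⟩ rfl
  have h2 : lam j ≤ lam ⟨i + 1, hi⟩ := hanti (Fin.le_def.2 hlt)
  have h3 : (lam j : ℝ) ≤ lam ⟨i + 1, hi⟩ := Nat.cast_le.2 h2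
  linarith

theorem lt_row_of_last (hanti : Antitone lam)
    (hlast : ∀ i : Fin d, (i : ℕ) + 1 = d → δ * n < (lam i : ℝ)) (i : Fin d) :
    δ * n < (lam i : ℝ) := by
  have hd : 0 < d := (Nat.zero_le _).trans_lt i.isLt
  have h1 := hlast ⟨d - 1, by omega⟩ (by simp; omega)
  have h2 : lam ⟨d - 1, by omega⟩ ≤ lam i := hanti (Fin.le_def.2 (by simp; omega))
  exact h1.trans_le (Nat.cast_le.2 h2)

theorem rpow_pow_three_div_le {η x δ : ℝ} (hx : 0 < x) (hδ : 0 < δ) (hδ1 : δ ≤ 1) :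
    (x ^ η) ^ 3 / (δ * x) ≤ x ^ (3 * η - 1) / δ ^ 2 := by
  have : (x ^ η) ^ 3 / (δ * x) = x ^ (3 * η - 1) / δ := by
    rw [← Real.rpow_mul_natCast hx.le, Real.rpow_sub hx, Real.rpow_one, mul_comm η]
    push_cast
    field_simp
  rw [this]
  gcongr
  nlinarith

/-- Since `ε ≤ 1`, `√ε ≤ ε^(1/6)`, which has exactly the factor `δ^(-1/3)`. Its exponent of `x` is
`(6η - 2)/12 ≤ (9η - 2)/12` as `η ≥ 0`. The base `(4K + 1)^(12/(9η - 2))` is chosen to yield the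
factor `4K + 1`. -/
theorem four_mul_le_rpow {K η x δ : ℝ} (hK : 0 ≤ K) (hη0 : 0 ≤ η) (hη : η < 2 / 9) (hx : 1 ≤ x)
    (hδ : 0 < δ) (hδ1 : δ ≤ 1) (hε : x ^ (3 * η - 1) / δ ^ 2 ≤ 1) :
    4 * (K * √((x ^ η) ^ 3 / (δ * x)))
      ≤ ((4 * K + 1) ^ (12 / (9 * η - 2)) * x) ^ ((9 * η - 2) / 12) * δ ^ (-(1 : ℝ) / 3) := by
  have hx0 : 0 < x := zero_lt_one.trans_le hx
  have he : 9 * η - 2 ≠ 0 := by linarith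
  set ε := x ^ (3 * η - 1) / δ ^ 2 with hεd
  have hε0 : 0 < ε := by positivity
  have h1 : (x ^ η) ^ 3 / (δ * x) ≤ ε := rpow_pow_three_div_le hx0 hδ hδ1
  have h2 : √((x ^ η) ^ 3 / (δ * x)) ≤ ε ^ ((1 : ℝ) / 6) := by
    refine (Real.sqrt_le_sqrt h1).trans ?_
    rw [Real.sqrt_eq_rpow]
    exact Real.rpow_le_rpow_of_exponent_ge hε0 hε (by norm_num)
  have h3 : ε ^ ((1 : ℝ) / 6) ≤ x ^ ((9 * η - 2) / 12) * δ ^ (-(1 : ℝ) / 3) := by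
    rw [hεd, Real.div_rpow (by positivity) (by positivity), ← Real.rpow_mul hx0.le,
      ← Real.rpow_natCast δ 2, ← Real.rpow_mul hδ.le, div_eq_mul_inv, ← Real.rpow_neg hδ.le]
    have : -(((2 : ℕ) : ℝ) * (1 / 6)) = -(1 : ℝ) / 3 := by norm_num
    rw [this]
    refine mul_le_mul_of_nonneg_right ?_ (by positivity)
    exact Real.rpow_le_rpow_of_exponent_le hx (by linarith)
  have h4 : ((4 * K + 1) ^ (12 / (9 * η - 2)) * x) ^ ((9 * η - 2) / 12)
      = (4 * K + 1) * x ^ ((9 * η - 2) / 12) := by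
    rw [Real.mul_rpow (by positivity) hx0.le, ← Real.rpow_mul (by positivity)]
    have : 12 / (9 * η - 2) * ((9 * η - 2) / 12) = 1 := by field_simp
    rw [this, Real.rpow_one]
  rw [h4, mul_assoc, ← mul_assoc 4 K]
  have h5 : 0 ≤ x ^ ((9 * η - 2) / 12) * δ ^ (-(1 : ℝ) / 3) := by positivity
  exact mul_le_mul (by linarith) (h2.trans h3) (Real.sqrt_nonneg _) (by linarith)

end Bounds

/-- For negative `η` only the tableau whose entries are the row indices is below the bound. -/
theorem Tableau.eq_of_total_le_rpow_of_neg {d : ℕ} {lam : Fin d → ℕ} (hanti : Antitone lam)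
    (hpos : ∀ i, 0 < lam i) {η : ℝ} (hη : η < 0) {m l : Tableau lam}
    (hm : (m.total : ℝ) ≤ ((∑ i, lam i : ℕ) : ℝ) ^ η)
    (hl : (l.total : ℝ) ≤ ((∑ i, lam i : ℕ) : ℝ) ^ η) : l = m := by
  -- For `d = 1` possibly `n = 1`, where `n^η` is not below 1; but then only one filling exists.
  rcases Nat.lt_or_ge 1 d with hd | hd
  · have hn : 1 < ∑ i, lam i := hd.trans_le <| by
      simpa using card_nsmul_le_sum univ lam 1 fun i _ => hpos i
    have hlt : ((∑ i, lam i : ℕ) : ℝ) ^ η < 1 :=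
      Real.rpow_lt_one_of_one_lt_of_neg (by exact_mod_cast hn) hη
    have hm0 : m.total = 0 := Nat.lt_one_iff.1 (by exact_mod_cast hm.trans_lt hlt)
    have hl0 : l.total = 0 := Nat.lt_one_iff.1 (by exact_mod_cast hl.trans_lt hlt)
    exact Subtype.ext ((l.eq_row_of_total_eq_zero hanti hl0).trans
      (m.eq_row_of_total_eq_zero hanti hm0).symm)
  · have : Subsingleton (Fin d) := Fin.subsingleton_iff_le_one.2 hd
    exact Subsingleton.elim _ _

/-- The constant `64 * (K + 1)^2` serves twice: it gives `K * √ε ≤ 1/8`, and `ε ≤ 1/64`, whence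
`N²/t ≤ 1/4`. -/
theorem sum_norm_inner_ket_le_rpow {d : ℕ} {lam : Fin d → ℕ} {η δ : ℝ} (hη0 : 0 ≤ η)
    (hη : η < 2 / 9) (hδ : 0 < δ) (hδ1 : δ ≤ 1) (hn : 1 ≤ ((∑ i, lam i : ℕ) : ℝ))
    (hgap : ∀ i j, i < j → δ * ((∑ i, lam i : ℕ) : ℝ) < (lam i : ℝ) - lam j)
    (hε : 64 * (((d : ℝ) ^ d) ^ 2 * d ^ 2 + 1) ^ 2
      * ((∑ i, lam i : ℕ) : ℝ) ^ (3 * η - 1) / δ ^ 2 < 1)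
    (m : Tableau lam) (hm : (m.total : ℝ) ≤ ((∑ i, lam i : ℕ) : ℝ) ^ η) :
    ∑ l : Tableau lam with l ≠ m ∧ (l.total : ℝ) ≤ ((∑ i, lam i : ℕ) : ℝ) ^ η,
        ‖inner ℂ m.ket l.ket‖
      ≤ ((4 * (((d : ℝ) ^ d) ^ 2 * d ^ 2) + 1) ^ (12 / (9 * η - 2))
          * ((∑ i, lam i : ℕ) : ℝ)) ^ ((9 * η - 2) / 12) * δ ^ (-(1 : ℝ) / 3) := by
  set x : ℝ := ((∑ i, lam i : ℕ) : ℝ) with hx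
  set K : ℝ := ((d : ℝ) ^ d) ^ 2 * d ^ 2 with hK
  have hK0 : 0 ≤ K := by positivity
  have hx0 : 0 < x := zero_lt_one.trans_le hn
  have hN : 1 ≤ x ^ η := Real.one_le_rpow hn hη0
  have ht : 0 < δ * x := mul_pos hδ hx0
  set ε := x ^ (3 * η - 1) / δ ^ 2 with hεd
  have hε0 : 0 < ε := by positivity
  have hε' : 64 * (K + 1) ^ 2 * ε < 1 := by rwa [hεd, ← mul_div_assoc]
  have h3 : (x ^ η) ^ 3 / (δ * x) ≤ ε := rpow_pow_three_div_le hx0 hδ hδ1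
  have hε64 : 64 * ε ≤ 1 := by
    nlinarith [mul_nonneg hK0 hε0.le, mul_nonneg hK0 (mul_nonneg hK0 hε0.le)]
  have hNt : (x ^ η) ^ 2 / (δ * x) ≤ 1 / 4 := by
    have : (x ^ η) ^ 2 / (δ * x) ≤ (x ^ η) ^ 3 / (δ * x) := by
      gcongr
      norm_num
    linarith
  have hsq : √((x ^ η) / (δ * x)) * x ^ η = √((x ^ η) ^ 3 / (δ * x)) := by
    rw [← Real.sqrt_sq (zero_le_one.trans hN), ← Real.sqrt_mul (by positivity),
      Real.sqrt_sq (zero_le_one.trans hN)]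
    congr 1
    ring
  have hXeq : ((d : ℝ) ^ d) ^ 2 * (√((x ^ η) / (δ * x)) * (d ^ 2 * x ^ η))
      = K * √((x ^ η) ^ 3 / (δ * x)) := by
    rw [← hsq, hK]
    ring
  have hX : K * √((x ^ η) ^ 3 / (δ * x)) ≤ 1 / 8 := by
    refine le_of_sq_le_sq ?_ (by norm_num)
    rw [mul_pow, Real.sq_sqrt (by positivity)]
    have h5 := mul_le_mul_of_nonneg_left h3 (sq_nonneg K)
    nlinarith [mul_nonneg hK0 hε0.le]
  have key := sum_norm_inner_ket_le hN ht hgap hNt (by rwa [hXeq]) m hm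
  rw [hXeq] at key
  exact key.trans (four_mul_le_rpow hK0 hη0 hη hn hδ hδ1 (by linarith))

end YoungOverlap

theorem corollary7p4 (d : ℕ) :
    ∃ C : ℝ, 0 < C ∧ ∀ η : ℝ, η < 2 / 9 →
      ∃ C'' : ℝ, 0 < C'' ∧
        ∀ (n : ℕ) (δ : ℝ) (lam : Fin d → ℕ),
          0 < δ →
          Antitone lam →
          ∑ i, lam i = n →
          (∀ i j : Fin d, (j : ℕ) = (i : ℕ) + 1 → δ * n < (lam i : ℝ) - (lam j : ℝ)) →
          (∀ i : Fin d, (i : ℕ) + 1 = d → δ * n < (lam i : ℝ)) →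
          C * (n : ℝ) ^ (3 * η - 1) / δ ^ 2 < 1 →
          ∀ m : YoungOverlap.Tableau lam, (m.total : ℝ) ≤ (n : ℝ) ^ η →
            ∑ l : YoungOverlap.Tableau lam with l ≠ m ∧ (l.total : ℝ) ≤ (n : ℝ) ^ η,
                ‖inner ℂ m.ket l.ket‖
              ≤ (C'' * n) ^ ((9 * η - 2) / 12) * δ ^ (-(1 : ℝ) / 3) := by
  refine ⟨64 * (((d : ℝ) ^ d) ^ 2 * d ^ 2 + 1) ^ 2, by positivity, fun η hη =>
    ⟨(4 * (((d : ℝ) ^ d) ^ 2 * d ^ 2) + 1) ^ (12 / (9 * η - 2)), by positivity, ?_⟩⟩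
  rintro n δ lam hδ hanti rfl hadj hlast hε m hm
  have hrow := YoungOverlap.lt_row_of_last hanti hlast
  have hgap := YoungOverlap.gap_of_adjacent hanti hadj
  have hpos : ∀ i, 0 < lam i := fun i => by
    have h1 : (0 : ℝ) < lam i := lt_of_le_of_lt (by positivity) (hrow i)
    exact_mod_cast h1
  -- In these cases no `l ≠ m` is admissible and the sum is empty.
  by_cases hunique : η < 0 ∨ d = 0
  · rw [Finset.sum_eq_zero]
    · positivity
    intro l hl
    simp only [Finset.mem_filter, Finset.mem_univ, true_and] at hl
    refine absurd ?_ hl.1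
    rcases hunique with hη0 | rfl
    · exact YoungOverlap.Tableau.eq_of_total_le_rpow_of_neg hanti hpos hη0 hm hl.2
    · exact Subsingleton.elim _ _
  · push Not at hunique
    obtain ⟨hη0, hd⟩ := hunique
    set i₀ : Fin d := ⟨0, Nat.pos_of_ne_zero hd⟩
    have hle : (lam i₀ : ℝ) ≤ ((∑ i, lam i : ℕ) : ℝ) :=
      Nat.cast_le.2 (YoungOverlap.le_sum_rows lam i₀)
    have hn : (1 : ℝ) ≤ ((∑ i, lam i : ℕ) : ℝ) :=
      le_trans (by exact_mod_cast hpos i₀) hle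
    -- The first row is longer than `δn` but has at most `n` boxes.
    have hδ1 : δ ≤ 1 := by
      by_contra hlt
      have := hrow i₀
      nlinarith
    exact YoungOverlap.sum_norm_inner_ket_le_rpow hη0 hη hδ hδ1 hn hgap hε m hm
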